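/- **Setting.** Take primary colors $a<b<c<d<e$ and the ten secondary colors $pq$ with $p<q$ primary, ordered by $$ab<ac<ad<ae<a<bc<bd<be<b<cd<ce<c<de<d<e .$$ A part $k_p$ has a size $k$ and a color $p$; $k\ge 1$ if $p$ is primary and $k\ge 2$ if $p$ is secondary; $k_p+m$ means $(k+m)_p$. Let $\chi(p\le q)$ be $1$ if $p\le q$ and $0$ otherwise, and let $k_p\succ l_q$ mean $k-l\ge\chi(p\le q)$ (a strict total order; $\succeq$ is its reflexive closure). A pair of secondary colors $(xy,zw)$ is special if $z<w<x<y$ or $x<z<w<y$. Put $k_p\triangleright l_q$ if $k_p\succeq (l+1)_q$ (when $p$ or $q$ is primary), resp. $k_p\succ(l+1)_q$ (when both are secondary). Put $k_p\gg l_q$ if $k_p\succ l_q$ when $(p,q)$ is special, and if $k_p\triangleright l_q$ otherwise. $\mathcal E$ is the set of finite sequences of parts $\nu_1\gg\cdots\gg\nu_t$. For primary $x<y$, the upper and lower halves of a secondary part are $\alpha(2k_{xy})=k_y$, $\beta(2k_{xy})=k_x$, $\alpha((2k+1)_{xy})=(k+1)_x$, $\beta((2k+1)_{xy})=k_y$;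 for a primary part put $\alpha(\nu_u)=\nu_u$. Given $\nu\in\mathcal E$ and an index $i$, the *bridge* of $i$ is the largest index $u$ such that $u=i$, or $u>i$, the parts $\nu_i,\dots,\nu_{u-1}$ are all secondary, and $\beta(\nu_t)\not\succ\alpha(\nu_u)+(u-t-1)$ for all $i\le t<u$. $\mathcal E_1$ is the set of $\nu\in\mathcal E$ such that, for every $i<t$ with $\nu_i\not\triangleright\nu_{i+1}$ and ($i=1$ or $\nu_{i-1}\triangleright\nu_i$), one has $\nu_i\succeq\alpha(\nu_u)+(u-i)$, where $u$ is the bridge of $i$. A pattern is an element of $\mathcal E$; it is *allowed* if it is in $\mathcal E_1$ and *forbidden* otherwise. A forbidden pattern is *optimal* if it becomes allowed after removing its first part, and also after removing its last part. **Notation.** The move $p\to q$ stands for two consecutive parts $(k+\chi(p\le q))_p,\,k_q$ where $(p,q)$ is special, and $p\twoheadrightarrow q$ for $(k+1+\chi(p\le q))_p,\,k_q$. The notation $c_1\circ\cdots\circ c_m\,,\,k$, with each $\circ$ one of $\to,\twoheadrightarrow$, is the pattern with colors $c_1,\dots,c_m$, with last part $k_{c_m}$, and with the sizes given by the moves. A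 move $\to p\to$ is given by two consecutive moves $\to$. Moves in parentheses are optional, $\langle\cdots\rangle^*$ means any finite, possibly empty, concatenation of the listed words, and "$X\twoheadrightarrow Y$" means a word of $X$ followed by $\twoheadrightarrow$ and a word of $Y$. Consider the families of words * $A_1= ad\to bc$, $\;A_2= be\to cd$, $\;A_3= de\to ab$, $\;A_4= de\to ac\,(\twoheadrightarrow ab)$, $\;A_5= ae\to bc$, $\;A_6= ae\to bd\,(\twoheadrightarrow bc)$; * $A_7= ae\to cd\,\langle\twoheadrightarrow A_2\rangle^*$, $\;A_8=A_7(\twoheadrightarrow be)(\twoheadrightarrow bd)(\twoheadrightarrow bc)$; * $A_9= de\to bc\,\langle\twoheadrightarrow A_8,\ \twoheadrightarrow A_6,\ \twoheadrightarrow A_5,\ (\twoheadrightarrow ae)\twoheadrightarrow A_1\rangle^*$, $\;A_{10}=A_9(\twoheadrightarrow ae)(\twoheadrightarrow ad)(\twoheadrightarrow ac)(\twoheadrightarrow ab)$; * $A_{14}= h\to ab\,\langle\twoheadrightarrow A_3,\ \twoheadrightarrow A_4,\ \twoheadrightarrow A_{10}\rangle^*$ with $h\in\{cd,ce\}$. **Theorem.**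 The optimal forbidden patterns with no move $\to p\to$ are exactly the following, where $k$ is the size of the last part. * $A_1\twoheadrightarrow a$, $k\ge2$; $\quad A_2\twoheadrightarrow b$, $k\ge2$; $\quad A_3\twoheadrightarrow d$ or $e$, $k\ge1$; $\quad A_4\twoheadrightarrow d$ or $e$, $k\ge1$; $\quad A_5\twoheadrightarrow a$, $k\ge2$; $\quad A_6\twoheadrightarrow a$, $k\ge2$. * Head $ae\to cd$: $\;ae\to cd\twoheadrightarrow b$, $k\ge2$; $\quad A_7\twoheadrightarrow a$, $k\ge2$; $\quad A_8\twoheadrightarrow a$, $k\ge2$. * Head $de\to bc$: $\;de\to bc\twoheadrightarrow a$, $k\ge2$; $\quad A_9\twoheadrightarrow e$, $k\ge1$; $\quad A_{10}\twoheadrightarrow e$, $k\ge1$; $\quad A_{10}\twoheadrightarrow d$, $k\ge2$; $\quad A_{10}\twoheadrightarrow d$, $k=1$, with the word of $A_{10}$ not ending by $ae$ or $be$; $\quad A_9\twoheadrightarrow A_7\twoheadrightarrow be$ or $bd$, $k=2$; $\quad A_9\twoheadrightarrow ae$, $k=2$; $\quad A_9\twoheadrightarrow ad$, $k=2$, with the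 word of $A_9$ not ending by $be$. * Heads $cd\to ab$ and $ce\to ab$ (with $h\in\{cd,ce\}$): $\;h\to ab\twoheadrightarrow d$ or $e$, $k\ge1$; $\quad A_{14}\twoheadrightarrow c$, $k\ge2$; $\quad A_{14}\twoheadrightarrow de\twoheadrightarrow c$, $k\ge2$; $\quad A_{14}\twoheadrightarrow c$, $k=1$, with the word of $A_{14}$ ending by $ac$, $ab$ or $bc$; $\quad A_{14}\twoheadrightarrow A_9\twoheadrightarrow A_7\twoheadrightarrow be\to cd$, $k=3$; $\quad A_{14}\twoheadrightarrow A_9\twoheadrightarrow ae\to cd$, $k=3$; $\quad A_{14}\twoheadrightarrow A_9\twoheadrightarrow ac$, $k=2$, with the word of $A_9$ ending by $bc$. In particular, the set of optimal forbidden patterns is infinite; even the set of color sequences of the optimal forbidden patterns with no move $\to p\to$ is infinite. -/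

import Mathlib

namespace ColoredPattern

/-- Colors over the ordered primary colors `0 < 1 < ... < n - 1`: the primary colors and the
secondary colors `a_i a_j` with `i < j`. -/
inductive Color (n : ℕ) : Type
  | prim (i : Fin n) : Color n
  | sec (i j : Fin n) (h : i < j) : Color n
  deriving DecidableEq

namespace Color

variable {n : ℕ}

/-- The color is a product of two distinct primary colors. -/
def IsSecondary : Color n → Prop
  | prim _ => False
  | sec _ _ _ => True

instance : DecidablePred (IsSecondary (n := n)) := fun p =>
  match p with
  | prim _ => .isFalse id
  | sec _ _ _ => .isTrue trivial

/-- Sort key of a color: `a_i a_j ↦ (i, j)` and `a_i ↦ (i, n)`. -/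
def key : Color n → ℕ × ℕ
  | prim i => (i, n)
  | sec i j _ => (i, j)

/-- The total order on colors
`a_1 a_2 < ... < a_1 a_n < a_1 < a_2 a_3 < ... < a_2 a_n < a_2 < ... < a_(n-1) a_n < a_(n-1) < a_n`,
i.e. the lexicographic order of the keys. -/
def Le (p q : Color n) : Prop :=
  p.key.1 < q.key.1 ∨ (p.key.1 = q.key.1 ∧ p.key.2 ≤ q.key.2)

instance (p q : Color n) : Decidable (Le p q) := by unfold Le; infer_instance

/-- `χ(p ≤ q)`. -/
def chi (p q : Color n) : ℕ := if Le p q then 1 else 0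

/-- The special pairs `(a_k a_l, a_i a_j)` with `i < j < k < l` or `k < i < j < l`. -/
def Special : Color n → Color n → Prop
  | sec k l _, sec i j _ => (i < j ∧ j < k ∧ k < l) ∨ (k < i ∧ i < j ∧ j < l)
  | _, _ => False

instance (p q : Color n) : Decidable (Special p q) := by
  cases p <;> cases q <;> unfold Special <;> infer_instance

end Color

/-- A colored part `k_p`. -/
structure Part (n : ℕ) : Type where
  size : ℕ
  color : Color n
  deriving DecidableEq

namespace Part

variable {n : ℕ}

/-- Adding an integer to a part changes its size and keeps its color. -/
def add (x : Part n) (m : ℕ) : Part n := ⟨x.size + m, x.color⟩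

/-- `k_p ≻ l_q` iff `k - l ≥ χ(p ≤ q)`. -/
def Succ (x y : Part n) : Prop := y.size + Color.chi x.color y.color ≤ x.size

instance (x y : Part n) : Decidable (Succ x y) := by unfold Succ; infer_instance

/-- `k_p ⪰ l_q`. -/
def SuccEq (x y : Part n) : Prop := Succ x y ∨ x = y

instance (x y : Part n) : Decidable (SuccEq x y) := by unfold SuccEq; infer_instance

/-- The relation `▷`. -/
def Tri (x y : Part n) : Prop :=
  if x.color.IsSecondary ∧ y.color.IsSecondary then Succ x (y.add 1) else SuccEq x (y.add 1)

instance (x y : Part n) : Decidable (Tri x y) := by unfold Tri; infer_instance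

/-- The relation `≫`. -/
def Gg (x y : Part n) : Prop :=
  if Color.Special x.color y.color then Succ x y
  else if x.color.IsSecondary ∧ y.color.IsSecondary then Succ x (y.add 1)
  else SuccEq x (y.add 1)

instance (x y : Part n) : Decidable (Gg x y) := by unfold Gg; infer_instance

/-- Parts with primary color have size at least `1`, parts with secondary color have size greater
than `1`. -/
def Valid (x : Part n) : Prop := if x.color.IsSecondary then 2 ≤ x.size else 1 ≤ x.size

instance (x : Part n) : Decidable (Valid x) := by unfold Valid; infer_instance

/-- Upper half: `(2k)_{a_i a_j} ↦ k_{a_j}`, `(2k+1)_{a_i a_j} ↦ (k+1)_{a_i}`; a part with primary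
color is kept. -/
def upper : Part n → Part n
  | ⟨s, .prim i⟩ => ⟨s, .prim i⟩
  | ⟨s, .sec i j _⟩ => if s % 2 = 0 then ⟨s / 2, .prim j⟩ else ⟨s / 2 + 1, .prim i⟩

/-- Lower half: `(2k)_{a_i a_j} ↦ k_{a_i}`, `(2k+1)_{a_i a_j} ↦ k_{a_j}`; only used for parts with
secondary color. -/
def lower : Part n → Part n
  | ⟨s, .prim i⟩ => ⟨s, .prim i⟩
  | ⟨s, .sec i j _⟩ => if s % 2 = 0 then ⟨s / 2, .prim i⟩ else ⟨s / 2, .prim j⟩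

end Part

section Partitions

variable {n : ℕ}

/-- The set `𝓔`: finite sequences of parts, consecutive parts being well-ordered by `≫`. -/
def InE (ν : List (Part n)) : Prop := (∀ x ∈ ν, x.Valid) ∧ ν.IsChain Part.Gg

instance (ν : List (Part n)) : Decidable (InE ν) := by unfold InE; infer_instance

/-- `ν_u` (if it is primary) or the upper half of `ν_u` (if it is secondary) reaches back to the
secondary part `ν_i`: all the parts `ν_i, ..., ν_(u-1)` are secondary, and for each such part `ν_t`,
its lower half is not `≻` that primary part increased by `u - t - 1`. -/
def Reaches (ν : List (Part n)) (i u : Fin ν.length) : Prop :=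
  i < u ∧ ∀ t : Fin ν.length, i ≤ t → t < u →
    (ν.get t).color.IsSecondary ∧
      ¬ Part.Succ (ν.get t).lower ((ν.get u).upper.add ((u : ℕ) - (t : ℕ) - 1))

instance (ν : List (Part n)) (i u : Fin ν.length) : Decidable (Reaches ν i u) := by
  unfold Reaches; infer_instance

/-- The index of the bridge of `ν_i`. Let `j` be the index of the first primary part to the right
of the secondary part `ν_i`. The bridge is at `j` if `j` exists and reaches back to `i`; otherwise
at the largest `u` between `i` and `j` that reaches back to `i`, if there is one; otherwise at `i`.
As `j` is larger than all the other candidates, this is the largest index which is `i` or reaches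
back to `i`. -/
def bridge (ν : List (Part n)) (i : Fin ν.length) : Fin ν.length :=
  (Finset.univ.filter fun u => u = i ∨ Reaches ν i u).max' ⟨i, by simp⟩

/-- `ν_(i-1) ▷ ν_i ⋫ ν_(i+1)`, where the first relation is void for the first part. -/
def Troublesome (ν : List (Part n)) (i : Fin ν.length) : Prop :=
  (∃ t : Fin ν.length, (t : ℕ) = (i : ℕ) + 1 ∧ ¬ Part.Tri (ν.get i) (ν.get t)) ∧
    ∀ t : Fin ν.length, (t : ℕ) + 1 = (i : ℕ) → Part.Tri (ν.get t) (ν.get i)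

instance (ν : List (Part n)) (i : Fin ν.length) : Decidable (Troublesome ν i) := by
  unfold Troublesome; infer_instance

/-- The set `𝓔₁`: the partitions of `𝓔` each of whose troublesome parts `ν_i` is
`1`-different-distant from its bridge; if the bridge sits in a secondary part, it is the upper half
of that part. -/
def InE1 (ν : List (Part n)) : Prop :=
  InE ν ∧ ∀ i : Fin ν.length, Troublesome ν i →
    Part.SuccEq (ν.get i)
      ((ν.get (bridge ν i)).upper.add ((bridge ν i : ℕ) - (i : ℕ)))

instance (ν : List (Part n)) : Decidable (InE1 ν) := by unfold InE1; infer_instance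

/-- A pattern (an element of `𝓔`) is allowed if it is in `𝓔₁` and forbidden if it is not. -/
def IsForbidden (ν : List (Part n)) : Prop := InE ν ∧ ¬ InE1 ν

instance (ν : List (Part n)) : Decidable (IsForbidden ν) := by unfold IsForbidden; infer_instance

/-- An optimal forbidden pattern: it is forbidden, and it is allowed after removing the first part
as well as after removing the last part. -/
def IsOptimalForbidden (ν : List (Part n)) : Prop :=
  IsForbidden ν ∧ InE1 ν.tail ∧ InE1 ν.dropLast

instance (ν : List (Part n)) : Decidable (IsOptimalForbidden ν) := by
  unfold IsOptimalForbidden; infer_instance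

/-- The move `p → q`: a special pair of colors and parts of the form `(k + χ(p ≤ q))_p, k_q`. -/
def IsStep (x y : Part n) : Prop :=
  Color.Special x.color y.color ∧ x.size = y.size + Color.chi x.color y.color

/-- The pattern contains a move `→ p →`: two consecutive moves `→`. -/
def HasDoubleStep (ν : List (Part n)) : Prop :=
  ∃ x y z : Part n, [x, y, z] <:+: ν ∧ IsStep x y ∧ IsStep y z

/-- The letters `→ c` and `↠ c` of which the notation `c₁ ∘ c₂ ∘ ⋯ ∘ c_m` is made. -/
inductive Move (n : ℕ) : Type
  | step (c : Color n) : Move n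
  | jump (c : Color n) : Move n
  deriving DecidableEq

/-- The color to which a move leads. -/
def Move.color : Move n → Color n
  | .step c => c
  | .jump c => c

/-- What a move adds to the minimal difference `χ(p ≤ q)`: `0` for `→` and `1` for `↠`. -/
def Move.gap : Move n → ℕ
  | .step _ => 0
  | .jump _ => 1

/-- Size of the first part of the pattern `c₁ ∘ c₂ ∘ ⋯ ∘ c_m , k`. -/
def firstSize : List (Move n) → ℕ → ℕ
  | [], k => k
  | [_], k => k
  | m :: m' :: w, k => firstSize (m' :: w) k + Color.chi m.color m'.color + m'.gap

/-- The pattern `c₁ ∘ c₂ ∘ ⋯ ∘ c_m , k`: its parts have the colors `c₁, ..., c_m`, its last part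
has size `k`, a move `p → q` stands for `(l + χ(p ≤ q))_p, l_q` and a move `p ↠ q` for
`(l + 1 + χ(p ≤ q))_p, l_q`. Only the color of the first letter matters: its arrow is the one
that precedes the pattern when it is inserted into a longer one. -/
def realize : List (Move n) → ℕ → List (Part n)
  | [], _ => []
  | m :: w, k => ⟨firstSize (m :: w) k, m.color⟩ :: realize w k

/-- The word ends by the color `c`. -/
def EndsBy (w : List (Move n)) (c : Color n) : Prop := ∃ m ∈ w.getLast?, m.color = c

end Partitions

/-! ### The families for the five primary colors `a < b < c < d < e` -/

namespace Five

abbrev a : Color 5 := .prim 0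
abbrev b : Color 5 := .prim 1
abbrev c : Color 5 := .prim 2
abbrev d : Color 5 := .prim 3
abbrev e : Color 5 := .prim 4
abbrev ab : Color 5 := .sec 0 1 (by decide)
abbrev ac : Color 5 := .sec 0 2 (by decide)
abbrev ad : Color 5 := .sec 0 3 (by decide)
abbrev ae : Color 5 := .sec 0 4 (by decide)
abbrev bc : Color 5 := .sec 1 2 (by decide)
abbrev bd : Color 5 := .sec 1 3 (by decide)
abbrev be : Color 5 := .sec 1 4 (by decide)
abbrev cd : Color 5 := .sec 2 3 (by decide)
abbrev ce : Color 5 := .sec 2 4 (by decide)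
abbrev de : Color 5 := .sec 3 4 (by decide)

open Move
open scoped Computability

/-- `p → q`, to be attached by `↠`. -/
def base (p q : Color 5) : Language (Move 5) := {[jump p, step q]}

/-- The move `↠ p`. -/
def jmp (p : Color 5) : Language (Move 5) := {[jump p]}

/-- The optional move `(↠ p)`. -/
def opt (p : Color 5) : Language (Move 5) := 1 + jmp p

/- Words of moves; products are concatenations, `+` is a union, and `L∗` consists of all
finite (possibly empty) iterations of words of `L`. -/

/-- `ad → bc` -/
def AdBc : Language (Move 5) := base ad bc

/-- `be → cd` -/
def BeCd : Language (Move 5) := base be cd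

/-- `de → ab` -/
def DeAb : Language (Move 5) := base de ab

/-- `de → ac (↠ ab)` -/
def DeAc : Language (Move 5) := base de ac * opt ab

/-- `ae → bc` -/
def AeBc : Language (Move 5) := base ae bc

/-- `ae → bd (↠ bc)` -/
def AeBd : Language (Move 5) := base ae bd * opt bc

/-- `ae → cd` followed by iterations of `↠ be → cd` -/
def AeCd : Language (Move 5) := base ae cd * BeCd∗

/-- `AeCd (↠ be) (↠ bd) (↠ bc)` -/
def AeCd' : Language (Move 5) := AeCd * opt be * opt bd * opt bc

/-- `de → bc` followed by iterations of `↠ AeCd'`, `↠ AeBd`, `↠ AeBc` and `(↠ ae) ↠ AdBc` -/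
def DeBc : Language (Move 5) := base de bc * (AeCd' + AeBd + AeBc + opt ae * AdBc)∗

/-- `DeBc (↠ ae) (↠ ad) (↠ ac) (↠ ab)` -/
def DeBc' : Language (Move 5) := DeBc * opt ae * opt ad * opt ac * opt ab

/-- `cd → ab` or `ce → ab`, followed by iterations of `↠ DeAb`, `↠ DeAc` and `↠ DeBc'` -/
def CAb : Language (Move 5) := (base cd ab + base ce ab) * (DeAb + DeAc + DeBc')∗

/-- The list of patterns. -/
inductive Listed : List (Part 5) → Prop
  -- head `ad → bc`
  | adbc_a {w k} : w ∈ AdBc → 2 ≤ k → Listed (realize (w ++ [jump a]) k)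
  -- head `be → cd`
  | becd_b {w k} : w ∈ BeCd → 2 ≤ k → Listed (realize (w ++ [jump b]) k)
  -- head `de → ab`
  | deab_d {w k} : w ∈ DeAb → 1 ≤ k → Listed (realize (w ++ [jump d]) k)
  | deab_e {w k} : w ∈ DeAb → 1 ≤ k → Listed (realize (w ++ [jump e]) k)
  -- head `de → ac`
  | deac_d {w k} : w ∈ DeAc → 1 ≤ k → Listed (realize (w ++ [jump d]) k)
  | deac_e {w k} : w ∈ DeAc → 1 ≤ k → Listed (realize (w ++ [jump e]) k)
  -- head `ae → bc`
  | aebc_a {w k} : w ∈ AeBc → 2 ≤ k → Listed (realize (w ++ [jump a]) k)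
  -- head `ae → bd`
  | aebd_a {w k} : w ∈ AeBd → 2 ≤ k → Listed (realize (w ++ [jump a]) k)
  -- head `ae → cd`
  | aecd_b {w k} : w ∈ base ae cd → 2 ≤ k → Listed (realize (w ++ [jump b]) k)
  | aecd_a {w k} : w ∈ AeCd → 2 ≤ k → Listed (realize (w ++ [jump a]) k)
  | aecd'_a {w k} : w ∈ AeCd' → 2 ≤ k → Listed (realize (w ++ [jump a]) k)
  -- head `de → bc`
  | debc_a {w k} : w ∈ base de bc → 2 ≤ k → Listed (realize (w ++ [jump a]) k)
  | debc_e {w k} : w ∈ DeBc → 1 ≤ k → Listed (realize (w ++ [jump e]) k)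
  | debc'_e {w k} : w ∈ DeBc' → 1 ≤ k → Listed (realize (w ++ [jump e]) k)
  | debc'_d {w k} : w ∈ DeBc' → 2 ≤ k → Listed (realize (w ++ [jump d]) k)
  | debc'_d_one {w} : w ∈ DeBc' → ¬ EndsBy w ae → ¬ EndsBy w be →
      Listed (realize (w ++ [jump d]) 1)
  | debc_be {w} : w ∈ DeBc * AeCd → Listed (realize (w ++ [jump be]) 2)
  | debc_bd {w} : w ∈ DeBc * AeCd → Listed (realize (w ++ [jump bd]) 2)
  | debc_ae {w} : w ∈ DeBc → Listed (realize (w ++ [jump ae]) 2)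
  | debc_ad {w} : w ∈ DeBc → ¬ EndsBy w be → Listed (realize (w ++ [jump ad]) 2)
  -- heads `cd → ab` and `ce → ab`
  | cab_d {w k} : w ∈ base cd ab + base ce ab → 1 ≤ k → Listed (realize (w ++ [jump d]) k)
  | cab_e {w k} : w ∈ base cd ab + base ce ab → 1 ≤ k → Listed (realize (w ++ [jump e]) k)
  | cab_c {w k} : w ∈ CAb → 2 ≤ k → Listed (realize (w ++ [jump c]) k)
  | cab_de_c {w k} : w ∈ CAb * jmp de → 2 ≤ k → Listed (realize (w ++ [jump c]) k)
  | cab_c_one {w} : w ∈ CAb → EndsBy w ac ∨ EndsBy w ab ∨ EndsBy w bc →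
      Listed (realize (w ++ [jump c]) 1)
  | cab_be_cd {w} : w ∈ CAb * DeBc * AeCd * jmp be → Listed (realize (w ++ [step cd]) 3)
  | cab_ae_cd {w} : w ∈ CAb * DeBc * jmp ae → Listed (realize (w ++ [step cd]) 3)
  | cab_ac {w} : w ∈ CAb * DeBc → EndsBy w bc → Listed (realize (w ++ [jump ac]) 2)

end Five

end ColoredPattern

namespace ColoredPattern

namespace Five

open Move
open scoped Computability

/-! Put every part at its place `15 * size + rank` on the integer line. Then `≻` is comparison of
places and adding 1 to a part adds 15. For a pattern with parts `p 0, ..., p n`, let the height of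
`p t` be `pos (p t) + 15 * t - pos (p 0)`. A `▷` relation leaving a secondary part strictly lowers
the height, and a step between special colors raises it by at least 1 and at most 14.

Three reductions make the problem finite. First, since the upper half of a secondary part is at most
its lower half plus 1, a failure seen from any index that reaches back is also seen from the bridge.
Membership in `𝓔₁` thus becomes the absence of violations (`inE1_iff`), and an optimal pattern has
exactly one violation, from its first part to its last (`isOptimalForbidden_iff`). Second, in such a
pattern all heights after the head lie above the positive height of the bridge, and without double
steps they never exceed 15. A height is known modulo 15 from the two colors, so it equals `hgt` of
the colors, and every size difference is the least possible one (`profile_of_optimal`). What remains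
is a word of letters subject to the local conditions `Ok` and `Next`, that is, a path in a finite
automaton, with a finite condition on its end. If the last part is secondary, its size can only be 2
or 3.

Third, the paths are matched with the regular expressions of the list. In one direction, a language
is attached to each letter and shown to be closed under appending admissible letters (`pl_next`,
`listed_of_profile`). In the other, the words of the listed languages are shown to be paths
(`Trav`), and a path with a good end has exactly the required violation
(`Profile.isOptimalForbidden`). All color computations are finite checks. Infinitude comes from
iterating `↠ be → cd`. -/

/-! ### Places of parts and of their halves -/

instance : Fintype (Color 5) where
  elems := {ab, ac, ad, ae, a, bc, bd, be, b, cd, ce, c, de, d, e}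
  complete := by
    rintro (i | ⟨i, j, h⟩)
    · revert i; decide
    · revert i j h; decide

/-- The rank of a color in the total order of the fifteen colors. -/
def rk (p : Color 5) : ℕ :=
  5 * p.key.1 - p.key.1 * (p.key.1 - 1) / 2 + (p.key.2 - p.key.1 - 1)

theorem rk_lt : ∀ p, rk p < 15 := by decide

theorem rk_inj : ∀ p q, rk p = rk q → p = q := by decide

theorem chi_eq : ∀ p q : Color 5, Color.chi p q = if rk p ≤ rk q then 1 else 0 := by decide

theorem special_secondary : ∀ p q : Color 5, Color.Special p q → p.IsSecondary ∧ q.IsSecondary := by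
  decide

theorem special_ne : ∀ p q : Color 5, Color.Special p q → rk p ≠ rk q := by
  decide

/-- The place of a part in the total order `≻`. -/
def pos (x : Part 5) : ℤ := 15 * x.size + rk x.color

theorem pos_add (x : Part 5) (m : ℕ) : pos (x.add m) = pos x + 15 * m := by
  simp only [pos, Part.add]; push_cast; ring

theorem succ_iff (x y : Part 5) : Part.Succ x y ↔ pos y < pos x := by
  have h1 := rk_lt x.color
  have h2 := rk_lt y.color
  simp only [Part.Succ, chi_eq, pos]
  split_ifs <;> omega

theorem pos_inj {x y : Part 5} (h : pos x = pos y) : x = y := by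
  have h1 := rk_lt x.color
  have h2 := rk_lt y.color
  cases x; cases y
  simp only [pos] at h h1 h2
  simp only [Part.mk.injEq]
  exact ⟨by omega, rk_inj _ _ (by omega)⟩

theorem succEq_iff (x y : Part 5) : Part.SuccEq x y ↔ pos y ≤ pos x := by
  rw [Part.SuccEq, succ_iff, le_iff_lt_or_eq]
  exact or_congr_right ⟨fun h => by rw [h], fun h => (pos_inj h).symm⟩

theorem tri_iff (x y : Part 5) : Part.Tri x y ↔
    if x.color.IsSecondary ∧ y.color.IsSecondary then pos y + 15 < pos x
    else pos y + 15 ≤ pos x := by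
  simp only [Part.Tri, succ_iff, succEq_iff, pos_add, Nat.cast_one, mul_one]

theorem gg_iff (x y : Part 5) : Part.Gg x y ↔
    if Color.Special x.color y.color then pos y < pos x else Part.Tri x y := by
  simp only [Part.Gg, succ_iff, Part.Tri]

theorem isStep_iff (x y : Part 5) : IsStep x y ↔
    Color.Special x.color y.color ∧ pos y < pos x ∧ pos x ≤ pos y + 15 := by
  have h1 := rk_lt x.color
  have h2 := rk_lt y.color
  refine and_congr_right fun h => ?_
  have h3 := special_ne _ _ h
  simp only [chi_eq, pos]
  split_ifs <;> omega

/-- Inside `𝓔` the relation `▷` can fail only at a special pair, and then the size difference is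
forced to be minimal. -/
theorem not_tri_iff {x y : Part 5} (h : Part.Gg x y) : ¬ Part.Tri x y ↔ IsStep x y := by
  rw [gg_iff] at h
  rw [isStep_iff]
  by_cases hs : Color.Special x.color y.color
  · rw [if_pos hs] at h
    rw [tri_iff, if_pos (special_secondary _ _ hs), not_lt]
    tauto
  · rw [if_neg hs] at h
    tauto

theorem gg_of_isStep {x y : Part 5} (h : IsStep x y) : Part.Gg x y := by
  rw [isStep_iff] at h
  rw [gg_iff, if_pos h.1]
  exact h.2.1

theorem gg_of_tri {x y : Part 5} (h : Part.Tri x y) : Part.Gg x y := by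
  rw [gg_iff]
  split_ifs with hs
  · rw [tri_iff, if_pos (special_secondary _ _ hs)] at h
    omega
  · exact h

/-- For a secondary color `p = xy`: the place of the upper half of `s_p`, minus the place of
`(s - s / 2)_p`. -/
def upOff (p : Color 5) (s : ℕ) : ℤ := rk (Part.upper ⟨s % 2, p⟩).color - rk p

/-- For a secondary color `p = xy`: the place of the lower half of `s_p`, minus the place of
`(s / 2)_p`. -/
def loOff (p : Color 5) (s : ℕ) : ℤ := rk (Part.lower ⟨s % 2, p⟩).color - rk p

theorem pos_upper {x : Part 5} (h : x.color.IsSecondary) :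
    pos x.upper = pos x - 15 * (x.size / 2 : ℕ) + upOff x.color x.size := by
  obtain ⟨s, i | ⟨i, j, hij⟩⟩ := x
  · exact h.elim
  · simp only [pos, upOff, Part.upper, Nat.mod_mod]
    split_ifs <;> simp only <;> omega

theorem pos_lower {x : Part 5} (h : x.color.IsSecondary) :
    pos x.lower = 15 * (x.size / 2 : ℕ) + rk x.color + loOff x.color x.size := by
  obtain ⟨s, i | ⟨i, j, hij⟩⟩ := x
  · exact h.elim
  · simp only [pos, loOff, Part.lower, Nat.mod_mod]
    split_ifs <;> simp only <;> omega

theorem upper_of_primary {x : Part 5} (h : ¬ x.color.IsSecondary) : x.upper = x := by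
  obtain ⟨s, i | ⟨i, j, hij⟩⟩ := x
  · rfl
  · exact absurd trivial h

theorem pos_upper_le {x : Part 5} (h : x.Valid) : pos x.upper ≤ pos x := by
  by_cases hx : x.color.IsSecondary
  · rw [pos_upper hx]
    rw [Part.Valid, if_pos hx] at h
    have h1 := rk_lt (Part.upper ⟨x.size % 2, x.color⟩).color
    simp only [upOff]
    omega
  · rw [upper_of_primary hx]

theorem off_le : ∀ p : Color 5, p.IsSecondary →
    upOff p 0 ≤ loOff p 0 + 15 ∧ upOff p 1 ≤ loOff p 1 := by
  decide

/-- The two halves of a secondary part differ by at most 1. This lets a violation be passed on to an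
index further right. -/
theorem pos_upper_le_lower {x : Part 5} (h : x.color.IsSecondary) :
    pos x.upper ≤ pos x.lower + 15 := by
  rw [pos_upper h, pos_lower h, pos]
  have h0 := off_le _ h
  rcases Nat.mod_two_eq_zero_or_one x.size with h1 | h1 <;>
    simp only [upOff, loOff, Nat.zero_mod, Nat.mod_succ] at h0 ⊢ <;>
    rw [h1] <;> omega

/-! ### Allowed and optimal patterns in terms of violations -/

section Indices

variable {ν : List (Part 5)} {p : ℕ → Part 5}

theorem inE_iff (hp : ∀ t (h : t < ν.length), ν[t] = p t) : InE ν ↔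
    (∀ t < ν.length, (p t).Valid) ∧ ∀ t, t + 1 < ν.length → Part.Gg (p t) (p (t + 1)) := by
  rw [InE, List.isChain_iff_getElem, List.forall_mem_iff_forall_getElem]
  refine and_congr (forall_congr' fun t => forall_congr' fun h => by rw [hp])
    (forall_congr' fun t => forall_congr' fun h => by rw [hp, hp])

theorem hasDoubleStep_iff (hp : ∀ t (h : t < ν.length), ν[t] = p t) : HasDoubleStep ν ↔
    ∃ t, t + 2 < ν.length ∧ IsStep (p t) (p (t + 1)) ∧ IsStep (p (t + 1)) (p (t + 2)) := by
  constructor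
  · rintro ⟨x, y, z, ⟨l, l', rfl⟩, hxy, hyz⟩
    refine ⟨l.length, by simp, ?_⟩
    rw [← hp _ (by simp), ← hp _ (by simp), ← hp _ (by simp)]
    simpa [List.getElem_append] using ⟨hxy, hyz⟩
  · rintro ⟨t, ht, h⟩
    refine ⟨p t, p (t + 1), p (t + 2), ⟨ν.take t, ν.drop (t + 3), ?_⟩, h⟩
    rw [← hp t (by omega), ← hp (t + 1) (by omega), ← hp (t + 2) (by omega)]
    conv_rhs => rw [← List.take_append_drop t ν, List.drop_eq_getElem_cons (by omega),
      List.drop_eq_getElem_cons (by omega), List.drop_eq_getElem_cons (by omega)]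
    simp

/-- The step at `i` is a violation of the condition that defines `𝓔₁`, as seen from `u`. -/
def Viol (p : ℕ → Part 5) (i u : ℕ) : Prop :=
  i < u ∧ IsStep (p i) (p (i + 1)) ∧
    (∀ t, i ≤ t → t < u → (p t).color.IsSecondary ∧
      pos (p t).lower ≤ pos (p u).upper + 15 * (u - t - 1)) ∧
    pos (p i) < pos (p u).upper + 15 * (u - i)

theorem viol_shift (i u : ℕ) : Viol (fun t => p (t + 1)) i u ↔ Viol p (i + 1) (u + 1) := by
  simp only [Viol, add_lt_add_iff_right]
  refine and_congr_right fun _ => and_congr_right fun _ => and_congr ⟨fun h t h1 h2 => ?_,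
    fun h t h1 h2 => ?_⟩ (by push_cast; rw [add_sub_add_right_eq_sub])
  · obtain ⟨t, rfl⟩ : ∃ t', t = t' + 1 := ⟨t - 1, by omega⟩
    have := h t (by omega) (by omega)
    push_cast
    rw [add_sub_add_right_eq_sub]
    exact this
  · have := h (t + 1) (by omega) (by omega)
    push_cast at this
    rwa [add_sub_add_right_eq_sub] at this

theorem reaches_iff (hp : ∀ t (h : t < ν.length), ν[t] = p t) (i u : Fin ν.length) :
    Reaches ν i u ↔ (i : ℕ) < u ∧ ∀ t, (i : ℕ) ≤ t → t < u → (p t).color.IsSecondary ∧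
      pos (p t).lower ≤ pos (p u).upper + 15 * (u - t - 1) := by
  simp only [Reaches, Fin.lt_def, Fin.le_def, List.get_eq_getElem, hp, succ_iff, pos_add, not_lt]
  refine and_congr_right fun hiu => ⟨fun h t h1 h2 => ?_, fun h t h1 h2 => ?_⟩
  · obtain ⟨h3, h4⟩ := h ⟨t, h2.trans u.2⟩ h1 h2
    refine ⟨h3, ?_⟩
    simp only at h4
    omega
  · obtain ⟨h3, h4⟩ := h t h1 h2
    exact ⟨h3, by omega⟩

theorem troublesome_iff (hp : ∀ t (h : t < ν.length), ν[t] = p t) (hE : InE ν)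
    (hd : ¬ HasDoubleStep ν) (i : Fin ν.length) :
    Troublesome ν i ↔ (i : ℕ) + 1 < ν.length ∧ IsStep (p i) (p (i + 1)) := by
  rw [inE_iff hp] at hE
  rw [hasDoubleStep_iff hp] at hd
  constructor
  · rintro ⟨⟨t, ht, h⟩, -⟩
    have hl : (i : ℕ) + 1 < ν.length := ht ▸ t.2
    simp only [List.get_eq_getElem, hp, ht] at h
    exact ⟨hl, (not_tri_iff (hE.2 i hl)).1 h⟩
  · rintro ⟨hl, h⟩
    refine ⟨⟨⟨i + 1, hl⟩, rfl, ?_⟩, fun t ht => ?_⟩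
    · simp only [List.get_eq_getElem, hp]
      rwa [not_tri_iff (hE.2 i hl)]
    · simp only [List.get_eq_getElem, hp]
      by_contra h'
      rw [← ht] at h hl
      rw [← ht, not_tri_iff (hE.2 t (by omega))] at h'
      exact hd ⟨t, hl, h', h⟩

theorem bridge_spec (ν : List (Part 5)) (i : Fin ν.length) :
    bridge ν i = i ∨ Reaches ν i (bridge ν i) := by
  have h := Finset.max'_mem (Finset.univ.filter fun u => u = i ∨ Reaches ν i u) ⟨i, by simp⟩
  rw [Finset.mem_filter] at h
  exact h.2

/-- This removes the maximum in the definition of the bridge: any index that reaches back and sees a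
failure can replace it. Without double steps, the troublesome parts are just the starts of steps. -/
theorem inE1_iff (hp : ∀ t (h : t < ν.length), ν[t] = p t) (hd : ¬ HasDoubleStep ν) :
    InE1 ν ↔ InE ν ∧ ∀ i u, u < ν.length → ¬ Viol p i u := by
  refine and_congr_right fun hE => ?_
  have hE' := (inE_iff hp).1 hE
  simp only [troublesome_iff hp hE hd, succEq_iff, pos_add, List.get_eq_getElem, hp]
  constructor
  · rintro h i u hu ⟨hiu, hs, hr, hlt⟩
    have hi := h ⟨i, by omega⟩ ⟨by simp only; omega, hs⟩
    set j := bridge ν ⟨i, by omega⟩ with hj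
    have huj : (⟨u, hu⟩ : Fin ν.length) ≤ j := Finset.le_max' _ _ (by
      rw [Finset.mem_filter, reaches_iff hp]
      exact ⟨Finset.mem_univ _, Or.inr ⟨hiu, hr⟩⟩)
    have huj' : u ≤ (j : ℕ) := huj
    have hmem : j = ⟨i, by omega⟩ ∨ Reaches ν ⟨i, by omega⟩ j :=
      bridge_spec ν _
    have hr' : Reaches ν ⟨i, by omega⟩ j := by
      refine hmem.resolve_left fun h => ?_
      rw [h] at huj'
      simp only at huj'
      omega
    rw [reaches_iff hp] at hr'
    simp only at hi hr'
    rcases huj'.eq_or_lt with h | h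
    · rw [← h] at hi
      omega
    -- The bridge `j` lies beyond `u`. The upper half at `u` is at most the lower half at `u` plus
    -- 1, which is at most the upper half at `j` plus `j - u`. So the failure seen from `u` is seen
    -- from `j`.
    · obtain ⟨h1, h2⟩ := hr'.2 u (by omega) h
      have := pos_upper_le_lower h1
      omega
  · rintro h i ⟨hl, hs⟩
    set j := bridge ν i with hj
    have hmem : j = i ∨ Reaches ν i j := bridge_spec ν i
    rcases hmem with h' | h'
    -- If the part is its own bridge, the condition holds because an upper half never exceeds its
    -- part.
    · rw [h']
      have := pos_upper_le (hE'.1 i i.2)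
      omega
    · rw [reaches_iff hp] at h'
      by_contra hlt
      exact h i j j.2 ⟨h'.1, hs, h'.2, by omega⟩

/-- Violations depend only on the parts between their two ends. Deleting an end part therefore keeps
every violation that avoids it, and optimality leaves only the one using both ends. -/
theorem isOptimalForbidden_iff {n : ℕ} (hn : ν.length = n + 1)
    (hp : ∀ t (h : t < ν.length), ν[t] = p t) (hd : ¬ HasDoubleStep ν) :
    IsOptimalForbidden ν ↔ InE ν ∧ Viol p 0 n ∧
      ∀ i u, u ≤ n → i ≠ 0 ∨ u ≠ n → ¬ Viol p i u := by
  have hp1 : ∀ t (h : t < ν.tail.length), ν.tail[t] = p (t + 1) := fun t h => by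
    rw [List.getElem_tail, hp]
  have hp2 : ∀ t (h : t < ν.dropLast.length), ν.dropLast[t] = p t := fun t h => by
    rw [List.getElem_dropLast, hp]
  have hd1 : ¬ HasDoubleStep ν.tail := fun ⟨x, y, z, h, h'⟩ =>
    hd ⟨x, y, z, h.trans (List.tail_suffix ν).isInfix, h'⟩
  have hd2 : ¬ HasDoubleStep ν.dropLast := fun ⟨x, y, z, h, h'⟩ =>
    hd ⟨x, y, z, h.trans (List.dropLast_prefix ν).isInfix, h'⟩
  rw [IsOptimalForbidden, IsForbidden, inE1_iff hp hd, inE1_iff (p := fun t => p (t + 1)) hp1 hd1,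
    inE1_iff hp2 hd2, List.length_tail, List.length_dropLast, hn, Nat.add_sub_cancel]
  simp only [viol_shift]
  constructor
  · rintro ⟨⟨hE, hf⟩, ⟨-, ht⟩, -, hdl⟩
    have h1 : ∀ i u, u ≤ n → i ≠ 0 ∨ u ≠ n → ¬ Viol p i u := by
      intro i u hu hiu hv
      rcases eq_or_ne u n with rfl | hne
      · have := hv.1
        refine ht (i - 1) (u - 1) (by omega) ?_
        rwa [Nat.sub_add_cancel (by omega), Nat.sub_add_cancel (by omega)]
      · exact hdl i u (by omega) hv
    refine ⟨hE, ?_, h1⟩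
    by_contra hv
    refine hf ⟨hE, fun i u hu hv' => ?_⟩
    by_cases h0 : i = 0 ∧ u = n
    · obtain ⟨rfl, rfl⟩ := h0
      exact hv hv'
    · exact h1 i u (by omega) (by tauto) hv'
  · rintro ⟨hE, hv, h⟩
    refine ⟨⟨hE, fun h' => h'.2 0 n (by omega) hv⟩, ⟨?_, fun i u hu => h _ _ (by omega) (by omega)⟩,
      ?_, fun i u hu => h _ _ (by omega) (by omega)⟩
    · exact ⟨fun x hx => hE.1 x (List.mem_of_mem_tail hx), hE.2.tail⟩
    · exact ⟨fun x hx => hE.1 x (List.mem_of_mem_dropLast hx), hE.2.dropLast⟩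

end Indices

/-! ### Heights are determined by colors -/

/-- The height of the color `q` above `p`: the number in `1, ..., 15` that is congruent to the
difference of the ranks modulo `15`. -/
def hgt (p q : Color 5) : ℕ := if rk p < rk q then rk q - rk p else rk q + 15 - rk p

/-- The largest height that a pattern without double steps and with head `p` can attain. -/
def top (p : Color 5) : ℕ :=
  if p = ad then 3 else if p = ae then 6 else if p = be then 2 else if p = cd then 15
  else if p = ce then 14 else if p = de then 12 else 0

theorem hgt_unique {p q : Color 5} {z : ℤ} (h1 : 0 < z) (h2 : z ≤ 15)
    (h : (15 : ℤ) ∣ z - (rk q - rk p)) : z = hgt p q := by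
  have hp := rk_lt p
  have hq := rk_lt q
  simp only [hgt]
  split_ifs <;> omega

theorem hgt_le (p q : Color 5) : 0 < hgt p q ∧ hgt p q ≤ 15 := by
  have hp := rk_lt p
  have hq := rk_lt q
  simp only [hgt]
  split_ifs <;> omega

theorem top_le : ∀ p, top p ≤ 15 := by decide

theorem hgt_le_top : ∀ p q, Color.Special p q → hgt p q ≤ top p := by decide

/-- A step taken strictly between height 1 and the top does not wrap around modulo 15. This is why
`hgt` stays the true height along a whole pattern. -/
theorem hgt_step : ∀ p q, Color.Special p q → ∀ p₀, 1 < hgt p₀ p → hgt p₀ p < top p₀ →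
    hgt p₀ p + hgt p q = hgt p₀ q ∧ hgt p₀ q ≤ top p₀ := by decide

theorem upOff_mod (p : Color 5) (s : ℕ) : upOff p s = upOff p (s % 2) := by
  rw [upOff, upOff, Nat.mod_mod]

/-- Excludes patterns of two parts: the upper half of the second part would have a height that is
not positive. -/
theorem hgt_upOff : ∀ p q, Color.Special p q →
    hgt p q + upOff q 0 ≤ 15 ∧ hgt p q + upOff q 1 ≤ 15 := by decide

instance (x y : Part 5) : Decidable (IsStep x y) := by unfold IsStep; infer_instance

/-- The letter of the word of a pattern for the part `y` after the part `x`. -/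
def letter (x y : Part 5) : Move 5 := if IsStep x y then .step y.color else .jump y.color

theorem letter_color (x y : Part 5) : (letter x y).color = y.color := by
  rw [letter]; split_ifs <;> rfl

theorem rk_ne_of_secondary : ∀ p q : Color 5, p.IsSecondary → ¬ q.IsSecondary → rk p ≠ rk q := by
  decide

theorem upper_primary (x : Part 5) : ¬ x.upper.color.IsSecondary := by
  obtain ⟨s, i | ⟨i, j, h⟩⟩ := x
  · exact id
  · simp only [Part.upper]
    split_ifs <;> exact id

/-- The weak inequality for a primary `y` is strict, because the ranks of a secondary and a primary
color differ. -/
theorem lt_of_tri {x y : Part 5} (hx : x.color.IsSecondary) (h : Part.Tri x y) :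
    pos y + 15 < pos x := by
  rw [tri_iff] at h
  split_ifs at h with hs
  · exact h
  · have := rk_ne_of_secondary _ y.color hx (by tauto)
    have := rk_lt x.color
    have := rk_lt y.color
    simp only [pos] at h ⊢
    omega

/-- The letter `m` can occur in a pattern with head `p`, after the head and before the last part,
if the bridge of the head has the color `f`. -/
def Ok (p f : Color 5) (m : Move 5) : Prop :=
  m.color.IsSecondary ∧ hgt p f < hgt p m.color ∧ hgt p m.color ≤ top p ∧
    (m = .jump m.color → hgt p m.color < top p) ∧ (m = .step m.color → ∃ q, Color.Special q m.color)

instance (p f : Color 5) : DecidablePred (Ok p f) := fun _ => by unfold Ok; infer_instance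

/-- The letter `m'` can follow the letter `m` in a pattern with head `p`. -/
def Next (p : Color 5) (m m' : Move 5) : Prop :=
  (m' = .jump m'.color → hgt p m'.color < hgt p m.color) ∧
    (m' = .step m'.color → Color.Special m.color m'.color ∧ m = .jump m.color)

instance (p : Color 5) (m m' : Move 5) : Decidable (Next p m m') := by unfold Next; infer_instance

/-- What the conditions on an optimal forbidden pattern without double steps say about the colors
of its parts and about its last two parts; `f` is the color of the bridge. -/
structure Profile (p : ℕ → Part 5) (n : ℕ) (f : Color 5) : Prop where
  special : Color.Special (p 0).color (p 1).color
  isStep : IsStep (p 0) (p 1)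
  ok : ∀ t, t + 1 < n → Ok (p 0).color f (letter (p t) (p (t + 1)))
  next : ∀ t, t + 1 < n →
    Next (p 0).color (letter (p t) (p (t + 1))) (letter (p (t + 1)) (p (t + 1 + 1)))
  size : ∀ t < n, (p t).size = (p (t + 1)).size + Color.chi (p t).color (p (t + 1)).color +
    (letter (p t) (p (t + 1))).gap
  valid : (p n).Valid
  color : f = (p n).upper.color
  height : pos (p n).upper - pos (p n) = hgt (p 0).color f - hgt (p 0).color (p n).color
  reach : pos (p (n - 1)).lower ≤ pos (p n).upper

/-- Heights are squeezed between that of the bridge and `top`, hence determined by colors. Only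
violations ending at the last part are used; those ending earlier turn out to be impossible anyway.
-/
theorem profile_of_optimal {p : ℕ → Part 5} {n : ℕ} (hval : ∀ t ≤ n, (p t).Valid)
    (hgg : ∀ t < n, Part.Gg (p t) (p (t + 1)))
    (hd : ∀ t, t + 1 < n → ¬ (IsStep (p t) (p (t + 1)) ∧ IsStep (p (t + 1)) (p (t + 1 + 1))))
    (hv : Viol p 0 n) (hnv : ∀ i, i ≠ 0 → ¬ Viol p i n) :
    2 ≤ n ∧ Profile p n (p n).upper.color := by
  obtain ⟨hn, hs0, hr, hlt⟩ := hv
  have hsp0 : Color.Special (p 0).color (p 1).color := ((isStep_iff _ _).1 hs0).1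
  obtain ⟨F, hF⟩ : ∃ F : ℤ, F = pos (p n).upper + 15 * n - pos (p 0) := ⟨_, rfl⟩
  -- `H t` is the height of `p t` and `F` that of the bridge; the violation says `0 < F`.
  obtain ⟨H, hH⟩ : ∃ H : ℕ → ℤ, ∀ t, H t = pos (p t) + 15 * t - pos (p 0) := ⟨_, fun _ => rfl⟩
  have hF0 : 0 < F := by push_cast at hlt; omega
  have hFn : F ≤ H n := by
    have := pos_upper_le (hval n le_rfl)
    rw [hF, hH]
    omega
  have hsec : ∀ t < n, (p t).color.IsSecondary := fun t ht => (hr t (Nat.zero_le _) ht).1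
  have hjump : ∀ t < n, ¬ IsStep (p t) (p (t + 1)) → H (t + 1) < H t := by
    intro t ht h
    have := lt_of_tri (hsec t ht) (by rwa [← not_tri_iff (hgg t ht), not_not] at h)
    rw [hH, hH]
    push_cast
    omega
  have hstart : ∀ t, 1 ≤ t → t < n → IsStep (p t) (p (t + 1)) → F < H t := by
    intro t h1 ht h
    have h2 : ¬ pos (p t) < pos (p n).upper + 15 * (n - t) := fun h' =>
      hnv t (by omega) ⟨ht, h, fun t' h1 h2 => hr t' (by omega) h2, h'⟩
    have h3 := rk_ne_of_secondary _ _ (hsec t ht) (upper_primary (p n))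
    have := rk_lt (p t).color
    have := rk_lt (p n).upper.color
    rw [hF, hH]
    simp only [pos] at h2 ⊢
    omega
  -- Induction from the right end: a jump comes from higher up, and a step starting at or below `F`
  -- would be a second violation.
  have hlow' : ∀ j t, t + j = n → 1 ≤ t → F ≤ H t ∧ (t < n → F < H t) := by
    intro j
    induction j with
    | zero => rintro t rfl -; exact ⟨hFn, fun h => absurd h (lt_irrefl _)⟩
    | succ j ih =>
      intro t ht h1
      suffices F < H t from ⟨this.le, fun _ => this⟩
      by_cases h : IsStep (p t) (p (t + 1))
      · exact hstart t h1 (by omega) h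
      · exact (ih (t + 1) (by omega) (by omega)).1.trans_lt (hjump t (by omega) h)
  have hlow : ∀ t, 1 ≤ t → t ≤ n → F ≤ H t := fun t h1 h2 => (hlow' (n - t) t (by omega) h1).1
  have hlow2 : ∀ t, 1 ≤ t → t < n → F < H t := fun t h1 h2 => (hlow' (n - t) t (by omega) h1).2 h2
  have hmod : ∀ t, (15 : ℤ) ∣ H t - (rk (p t).color - rk (p 0).color) := by
    intro t
    rw [hH, pos, pos]
    omega
  have hstep : ∀ t < n, IsStep (p t) (p (t + 1)) →
      H (t + 1) = H t + hgt (p t).color (p (t + 1)).color := by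
    intro t ht h
    rw [isStep_iff] at h
    have h1 := special_ne _ _ h.1
    have h2 := rk_lt (p t).color
    have h3 := rk_lt (p (t + 1)).color
    rw [hH, hH, hgt]
    simp only [pos] at h ⊢
    split_ifs <;> push_cast <;> omega
  have hup : ∀ t, t < n → H (t + 1) = hgt (p 0).color (p (t + 1)).color ∧
      hgt (p 0).color (p (t + 1)).color ≤ top (p 0).color ∧
      (¬ IsStep (p t) (p (t + 1)) →
        hgt (p 0).color (p (t + 1)).color < top (p 0).color) := by
    intro t
    induction t with
    | zero =>
      intro _
      have h0 : H 0 = 0 := by rw [hH]; push_cast; ring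
      have h1 := hstep 0 hn hs0
      rw [h0, zero_add] at h1
      simp only [zero_add]
      exact ⟨h1.trans (zero_add _), hgt_le_top _ _ hsp0, fun h => absurd hs0 h⟩
    | succ t ih =>
      intro ht
      obtain ⟨h1, h2, h3⟩ := ih (by omega)
      have h4 := hlow2 (t + 1) (by omega) ht
      by_cases h : IsStep (p (t + 1)) (p (t + 1 + 1))
      · have h5 := h3 fun h' => hd t ht ⟨h', h⟩
        obtain ⟨h6, h7⟩ := hgt_step _ _ ((isStep_iff _ _).1 h).1 _ (by omega) h5
        have h8 := hstep _ ht h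
        exact ⟨by omega, h7, fun h' => absurd h h'⟩
      · have h5 := hjump _ ht h
        have h6 := hlow (t + 1 + 1) (by omega) ht
        have h7 := top_le (p 0).color
        have h8 := hgt_unique (by omega) (by omega) (hmod (t + 1 + 1))
        exact ⟨h8, by omega, fun _ => by omega⟩
  have hFf : F = hgt (p 0).color (p n).upper.color := by
    have h1 := hup (n - 1) (by omega)
    rw [Nat.sub_add_cancel (by omega)] at h1
    have := top_le (p 0).color
    refine hgt_unique hF0 (by omega) ?_
    rw [hF, pos, pos]
    omega
  have hheight : pos (p n).upper - pos (p n) =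
      hgt (p 0).color (p n).upper.color - hgt (p 0).color (p n).color := by
    have h1 := (hup (n - 1) (by omega)).1
    rw [Nat.sub_add_cancel (by omega), hH] at h1
    omega
  have hreach := (hr (n - 1) (Nat.zero_le _) (by omega)).2
  rw [Nat.cast_sub (by omega)] at hreach
  have hok : ∀ t, t + 1 < n → Ok (p 0).color (p n).upper.color (letter (p t) (p (t + 1))) := by
    intro t ht
    obtain ⟨h1, h2, h3⟩ := hup t (by omega)
    have h4 := hlow2 (t + 1) (by omega) ht
    simp only [Ok, letter_color]
    refine ⟨hsec _ ht, by omega, h2, fun h => h3 fun h' => ?_, fun h => ?_⟩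
    · rw [letter, if_pos h'] at h
      cases h
    · by_cases h' : IsStep (p t) (p (t + 1))
      · exact ⟨_, h'.1⟩
      · rw [letter, if_neg h'] at h
        cases h
  refine ⟨?_, hsp0, hs0, hok, ?_, ?_, hval n le_rfl, rfl, hheight, by push_cast at hreach; omega⟩
  · by_contra h
    obtain rfl : n = 1 := by omega
    have h1 := hgt_upOff _ _ hsp0
    have h2 := (special_secondary _ _ hsp0).2
    have h3 := hgt_le (p 0).color (p 1).upper.color
    have h4 := hval 1 le_rfl
    rw [Part.Valid, if_pos h2] at h4
    have h5 := upOff_mod (p 1).color (p 1).size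
    rw [pos_upper h2, h5] at hheight
    rcases Nat.mod_two_eq_zero_or_one (p 1).size with h6 | h6 <;> rw [h6] at hheight <;> omega
  · intro t ht
    simp only [Next, letter_color]
    refine ⟨fun h => ?_, fun h => ?_⟩
    · have h1 := (hup t (by omega)).1
      have h2 := (hup (t + 1) (by omega)).1
      have h3 := hjump (t + 1) ht fun h' => by
        rw [letter, if_pos h'] at h
        cases h
      omega
    · by_cases h' : IsStep (p (t + 1)) (p (t + 1 + 1))
      · refine ⟨h'.1, ?_⟩
        rw [letter, if_neg fun h => hd t ht ⟨h, h'⟩]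
      · rw [letter, if_neg h'] at h
        cases h
  · intro t ht
    by_cases h : IsStep (p t) (p (t + 1))
    · rw [letter, if_pos h]
      exact h.2
    · rw [letter, if_neg h]
      -- Both heights lie between 1 and 15, so the drop is between 1 and 14 and the places differ by
      -- 16 to 29. This leaves one possible size difference.
      have ht0 : t ≠ 0 := by rintro rfl; exact h hs0
      have h1 := (hup t ht).1
      have h2 := hlow (t + 1) (by omega) ht
      have h3 := hup (t - 1) (by omega)
      rw [Nat.sub_add_cancel (by omega)] at h3
      have h4 := top_le (p 0).color
      have h5 := hjump t ht h
      have h6 := rk_lt (p t).color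
      have h7 := rk_lt (p (t + 1)).color
      rw [hH] at h5 h2
      rw [hH] at h5
      have h8 := h3.1
      rw [hH] at h8
      simp only [pos, chi_eq, Move.gap] at *
      split_ifs <;> omega

instance : Fintype (Move 5) where
  elems := Finset.univ.image step ∪ Finset.univ.image jump
  complete := by rintro (q | q) <;> simp

/-! ### Membership in products and iterations of languages -/

section Languages

variable {L L' M : Language (Move 5)} {x y : List (Move 5)} {p q : Color 5} {m : Move 5}

theorem mem_base : x ∈ base p q ↔ x = [jump p, step q] := Iff.rfl

theorem mem_mul_jmp (h : x ∈ L) : x ++ [jump p] ∈ L * jmp p :=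
  Language.append_mem_mul h rfl

theorem mem_mul_opt (h : x ∈ L) : x ∈ L * opt p :=
  ⟨x, h, [], Or.inl rfl, List.append_nil x⟩

theorem jump_mem_mul_opt (h : x ∈ L) : x ++ [jump p] ∈ L * opt p :=
  Language.append_mem_mul h (Or.inr rfl)

theorem mul_jmp_le_mul_opt (h : x ∈ L * jmp p) : x ∈ L * opt p := by
  obtain ⟨y, hy, z, hz, rfl⟩ := h
  exact ⟨y, hy, z, Or.inr hz, rfl⟩

theorem step_mem_mul_base (h : x ∈ L * jmp p) : x ++ [step q] ∈ L * base p q := by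
  obtain ⟨y, hy, _, rfl, rfl⟩ := h
  exact ⟨y, hy, _, rfl, by simp⟩

theorem append_mem_mul_star (h : x ∈ L * M∗) (hy : y ∈ M) : x ++ y ∈ L * M∗ := by
  obtain ⟨z, hz, u, hu, rfl⟩ := h
  rw [List.append_assoc]
  refine Language.append_mem_mul hz ?_
  obtain ⟨S, rfl, hS⟩ := Language.mem_kstar.1 hu
  refine Language.mem_kstar.2 ⟨S ++ [y], by simp, ?_⟩
  simpa [or_imp, forall_and] using ⟨hS, hy⟩

theorem mem_mul_star (h : x ∈ L) : x ∈ L * M∗ :=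
  ⟨x, h, [], Language.nil_mem_kstar M, List.append_nil x⟩

theorem mul_mul_star_le : L * M∗ * M ≤ L * M∗ := by
  rintro _ ⟨x, hx, y, hy, rfl⟩
  exact append_mem_mul_star hx hy

/-- The words that are iterated in `DeBc`. -/
def DeBcLoop : Language (Move 5) := AeCd' + AeBd + AeBc + opt ae * AdBc

/-- The words that are iterated in `CAb`. -/
def CAbLoop : Language (Move 5) := DeAb + DeAc + DeBc'

theorem deBc_mul_loop : DeBc * DeBcLoop ≤ DeBc := mul_mul_star_le

theorem cAb_mul_loop : CAb * CAbLoop ≤ CAb := mul_mul_star_le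

end Languages

/-! ### Words of patterns -/

section Words

variable {p : ℕ → Part 5} {n : ℕ} {f : Color 5}

/-- The word of the pattern `p 0, ..., p n`. -/
def word (p : ℕ → Part 5) (n : ℕ) : List (Move 5) :=
  jump (p 0).color :: (List.range n).map fun t => letter (p t) (p (t + 1))

theorem word_succ (p : ℕ → Part 5) (n : ℕ) :
    word p (n + 1) = word p n ++ [letter (p n) (p (n + 1))] := by
  simp [word, List.range_succ]

theorem realize_word (p : ℕ → Part 5) (n : ℕ) (m : Move 5) (hm : m.color = (p 0).color)
    (h : ∀ t < n, (p t).size = (p (t + 1)).size + Color.chi (p t).color (p (t + 1)).color +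
      (letter (p t) (p (t + 1))).gap) :
    realize (m :: (List.range n).map fun t => letter (p t) (p (t + 1))) (p n).size =
      (List.range (n + 1)).map p := by
  induction n generalizing p m with
  | zero => simp [realize, firstSize, hm]
  | succ n ih =>
    have h1 := ih (fun t => p (t + 1)) (letter (p 0) (p 1)) (letter_color _ _)
      fun t ht => h (t + 1) (by omega)
    rw [List.range_succ_eq_map (n := n + 1), List.range_succ_eq_map (n := n)]
    simp only [List.map_cons, List.map_map]
    simp only [Function.comp_def, Nat.succ_eq_add_one, zero_add]
    rw [realize, h1, firstSize]
    have h2 : firstSize (letter (p 0) (p 1) ::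
        (List.range n).map fun t => letter (p (t + 1)) (p (t + 1 + 1))) (p (n + 1)).size =
        (p 1).size := by
      rw [realize, List.range_succ_eq_map, List.map_cons, List.cons.injEq] at h1
      exact congrArg Part.size h1.1
    rw [h2, hm, letter_color, ← h 0 (by omega)]
    simp [List.range_succ_eq_map]

/-- Invariance along the automaton: it suffices that the languages attached to the letters are
closed under admissible transitions. -/
theorem Profile.word_mem (hP : Profile p n f) {pl : Move 5 → Language (Move 5)}
    (hstart : [jump (p 0).color, step (p 1).color] ∈ pl (step (p 1).color))
    (hnext : ∀ m m', Ok (p 0).color f m → Ok (p 0).color f m' → Next (p 0).color m m' →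
      ∀ x ∈ pl m, x ++ [m'] ∈ pl m') (t : ℕ) (ht : t + 1 < n) :
    word p (t + 1) ∈ pl (letter (p t) (p (t + 1))) := by
  induction t with
  | zero => simpa [word, letter, hP.isStep] using hstart
  | succ t ih =>
    rw [word_succ]
    exact hnext _ _ (hP.ok t (by omega)) (hP.ok _ ht) (hP.next t (by omega)) _ (ih (by omega))

theorem endsBy_word (p : ℕ → Part 5) (n : ℕ) (q : Color 5) :
    EndsBy (word p n) q ↔ (p n).color = q := by
  cases n with
  | zero => simp [EndsBy, word, Move.color]
  | succ n => simp [EndsBy, word_succ, letter_color]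

end Words

/-! ### The automaton and its languages -/

section Letters

variable {D A A' B E : Language (Move 5)} {x : List (Move 5)} {m : Move 5}

/-- The words that lead to a given letter after the heads `cd`, `ce` and `de`, in terms of the
words that lead to the last letter of `DeBc` and to the letters `→ ab`, `↠ ab`, `→ ac`, `↠ de`. -/
def pl (D A A' B E : Language (Move 5)) (m : Move 5) : Language (Move 5) :=
  if m = step cd then D * AeCd
  else if m = jump be then D * AeCd * jmp be
  else if m = jump bd then D * AeCd * opt be * jmp bd
  else if m = step bd then D * base ae bd
  else if m = jump bc then D
  else if m = step bc then D
  else if m = jump ae then D * jmp ae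
  else if m = jump ad then D * opt ae * jmp ad
  else if m = jump ac then D * opt ae * opt ad * jmp ac
  else if m = jump ab then A'
  else if m = step ab then A
  else if m = step ac then B
  else if m = jump de then E
  else 0

/-- The letters that can precede a given one. -/
def src (m : Move 5) : List (Move 5) :=
  if m = step cd then [jump ae, jump be]
  else if m = jump be then [step cd]
  else if m = jump bd then [step cd, jump be]
  else if m = step bd then [jump ae]
  else if m = jump bc then [step cd, jump be, jump bd, step bd]
  else if m = step bc then [jump ae, jump ad, jump de]
  else if m = jump ae then [step cd, jump be, jump bd, step bd, jump bc, step bc]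
  else if m = jump ad then [step cd, jump be, jump bd, step bd, jump bc, step bc, jump ae]
  else if m = jump ac then
    [step cd, jump be, jump bd, step bd, jump bc, step bc, jump ae, jump ad]
  else if m = jump ab then
    [step cd, jump be, jump bd, step bd, jump bc, step bc, jump ae, jump ad, jump ac, step ac]
  else if m = step ab then [jump de]
  else if m = step ac then [jump de]
  else if m = jump de then
    [step cd, jump be, jump bd, step bd, jump bc, step bc, jump ae, jump ad, jump ac, step ac,
      jump ab, step ab]
  else []

/-- One state diagram serves all three heads. The letter `↠ de` is excluded after the head `de`
because `de` has height 15 above itself, more than the top 12. -/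
theorem mem_src : ∀ p ∈ [cd, ce, de], ∀ f ∈ [c, d, e], ∀ m, Ok p f m → ∀ m', Ok p f m' →
    Next p m m' → m ∈ src m' ∧
      m' ∈ [step cd, jump be, jump bd, step bd, jump bc, step bc, jump ae, jump ad, jump ac,
        jump ab, step ab, step ac, jump de] ∧ (p = de → m' ≠ jump de) := by
  decide +kernel

end Letters

/-! ### Closure of the languages under admissible letters -/

section Closure

variable {D A A' B E : Language (Move 5)} {x : List (Move 5)} {m m' : Move 5}

theorem aeCd'_loop (hD : D * DeBcLoop ≤ D) : D * AeCd * opt be * opt bd * opt bc ≤ D := by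
  refine le_trans (le_of_eq ?_) ((mul_le_mul_right (show AeCd' ≤ DeBcLoop from ?_) D).trans hD)
  · simp only [AeCd', mul_assoc]
  · exact fun x hx => Or.inl (Or.inl (Or.inl hx))

theorem mul_base_aeCd_le : D * base ae cd ≤ D * AeCd :=
  mul_le_mul_right (fun _ h => mem_mul_star h) D

/-- These letters end complete rounds of the iteration in `DeBc`, the optional letters being omitted
where necessary. -/
theorem deBcPrefix_le (hD : D * DeBcLoop ≤ D)
    (hm : m ∈ [step cd, jump be, jump bd, step bd, jump bc, step bc]) (hx : x ∈ pl D A A' B E m) :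
    x ∈ D := by
  have h1 := aeCd'_loop hD
  simp only [List.mem_cons, List.not_mem_nil, or_false] at hm
  rcases hm with rfl | rfl | rfl | rfl | rfl | rfl
  · exact h1 (mem_mul_opt (mem_mul_opt (mem_mul_opt hx)))
  · exact h1 (mem_mul_opt (mem_mul_opt (mul_jmp_le_mul_opt hx)))
  · exact h1 (mem_mul_opt (mul_jmp_le_mul_opt hx))
  · refine hD (mul_le_mul_right (show AeBd ≤ DeBcLoop from ?_) D ?_)
    · exact fun x hx => Or.inl (Or.inl (Or.inr hx))
    · rw [AeBd, ← mul_assoc]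
      exact mem_mul_opt hx
  · exact hx
  · exact hx

theorem mul_opt_ae_of_pl (hD : D * DeBcLoop ≤ D)
    (hm : m ∈ [step cd, jump be, jump bd, step bd, jump bc, step bc, jump ae])
    (hx : x ∈ pl D A A' B E m) : x ∈ D * opt ae := by
  have h : m ∈ [step cd, jump be, jump bd, step bd, jump bc, step bc] ∨ m = jump ae := by
    simp only [List.mem_cons, List.not_mem_nil, or_false] at hm ⊢; tauto
  rcases h with h | rfl
  · exact mem_mul_opt (deBcPrefix_le hD h hx)
  · exact mul_jmp_le_mul_opt hx

theorem mul_opt_ad_of_pl (hD : D * DeBcLoop ≤ D)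
    (hm : m ∈ [step cd, jump be, jump bd, step bd, jump bc, step bc, jump ae, jump ad])
    (hx : x ∈ pl D A A' B E m) : x ∈ D * opt ae * opt ad := by
  have h : m ∈ [step cd, jump be, jump bd, step bd, jump bc, step bc, jump ae] ∨ m = jump ad := by
    simp only [List.mem_cons, List.not_mem_nil, or_false] at hm ⊢; tauto
  rcases h with h | rfl
  · exact mem_mul_opt (mul_opt_ae_of_pl hD h hx)
  · exact mul_jmp_le_mul_opt hx

theorem mul_opt_ac_of_pl (hD : D * DeBcLoop ≤ D)
    (hm : m ∈ [step cd, jump be, jump bd, step bd, jump bc, step bc, jump ae, jump ad, jump ac])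
    (hx : x ∈ pl D A A' B E m) : x ∈ D * opt ae * opt ad * opt ac := by
  have h : m ∈ [step cd, jump be, jump bd, step bd, jump bc, step bc, jump ae, jump ad] ∨
      m = jump ac := by
    simp only [List.mem_cons, List.not_mem_nil, or_false] at hm ⊢; tauto
  rcases h with h | rfl
  · exact mem_mul_opt (mul_opt_ad_of_pl hD h hx)
  · exact mul_jmp_le_mul_opt hx

/-- Adding a letter leads from `pl D A A' B E` to itself. -/
theorem pl_next (hD : D * DeBcLoop ≤ D) (hA' : D * opt ae * opt ad * opt ac * jmp ab ≤ A')
    (hB : B * jmp ab ≤ A') (hEA : E * {[step ab]} ≤ A) (hEB : E * {[step ac]} ≤ B)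
    (hED : E * {[step bc]} ≤ D) (hm : m ∈ src m')
    (hE : m' = jump de → ∀ x ∈ pl D A A' B E m, x ++ [jump de] ∈ E)
    (hm' : m' ∈ [step cd, jump be, jump bd, step bd, jump bc, step bc, jump ae, jump ad, jump ac,
        jump ab, step ab, step ac, jump de])
    (hx : x ∈ pl D A A' B E m) : x ++ [m'] ∈ pl D A A' B E m' := by
  simp only [List.mem_cons, List.not_mem_nil, or_false] at hm'
  rcases hm' with rfl | rfl | rfl | rfl | rfl | rfl | rfl | rfl | rfl | rfl | rfl | rfl | rfl
  · have hm : m ∈ [jump ae, jump be] := hm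
    simp only [List.mem_cons, List.not_mem_nil, or_false] at hm
    rcases hm with rfl | rfl
    · exact mul_base_aeCd_le (step_mem_mul_base hx)
    · have h : D * AeCd * base be cd ≤ D * AeCd := by
        rw [mul_assoc]
        exact mul_le_mul_right mul_mul_star_le D
      exact h (step_mem_mul_base hx)
  · obtain rfl : m = step cd := List.mem_singleton.1 hm
    exact mem_mul_jmp hx
  · have hm : m ∈ [step cd, jump be] := hm
    simp only [List.mem_cons, List.not_mem_nil, or_false] at hm
    rcases hm with rfl | rfl
    · exact mem_mul_jmp (mem_mul_opt hx)
    · exact mem_mul_jmp (mul_jmp_le_mul_opt hx)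
  · obtain rfl : m = jump ae := List.mem_singleton.1 hm
    exact step_mem_mul_base hx
  · have hm : m ∈ [step cd, jump be, jump bd, step bd] := hm
    have h1 := aeCd'_loop hD
    simp only [List.mem_cons, List.not_mem_nil, or_false] at hm
    rcases hm with rfl | rfl | rfl | rfl
    · exact h1 (jump_mem_mul_opt (mem_mul_opt (mem_mul_opt hx)))
    · exact h1 (jump_mem_mul_opt (mem_mul_opt (mul_jmp_le_mul_opt hx)))
    · exact h1 (jump_mem_mul_opt (mul_jmp_le_mul_opt hx))
    · refine hD (mul_le_mul_right (show AeBd ≤ DeBcLoop from ?_) D ?_)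
      · exact fun x hx => Or.inl (Or.inl (Or.inr hx))
      · rw [AeBd, ← mul_assoc]
        exact jump_mem_mul_opt hx
  · have hm : m ∈ [jump ae, jump ad, jump de] := hm
    simp only [List.mem_cons, List.not_mem_nil, or_false] at hm
    rcases hm with rfl | rfl | rfl
    · exact hD (mul_le_mul_right (show AeBc ≤ DeBcLoop from fun x hx => Or.inl (Or.inr hx)) D
        (step_mem_mul_base hx))
    · refine hD (mul_le_mul_right (show opt ae * AdBc ≤ DeBcLoop from fun x hx => Or.inr hx) D ?_)
      rw [← mul_assoc]
      exact step_mem_mul_base hx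
    · exact hED (Language.append_mem_mul hx rfl)
  · exact mem_mul_jmp (deBcPrefix_le hD hm hx)
  · exact mem_mul_jmp (mul_opt_ae_of_pl hD hm hx)
  · exact mem_mul_jmp (mul_opt_ad_of_pl hD hm hx)
  · have h : m ∈ [step cd, jump be, jump bd, step bd, jump bc, step bc, jump ae, jump ad, jump ac] ∨
        m = step ac := by
      have hm : m ∈ [step cd, jump be, jump bd, step bd, jump bc, step bc, jump ae, jump ad,
        jump ac, step ac] := hm
      simp only [List.mem_cons, List.not_mem_nil, or_false] at hm ⊢; tauto
    rcases h with h | rfl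
    · exact hA' (mem_mul_jmp (mul_opt_ac_of_pl hD h hx))
    · exact hB (mem_mul_jmp hx)
  · obtain rfl : m = jump de := List.mem_singleton.1 hm
    exact hEA (Language.append_mem_mul hx rfl)
  · obtain rfl : m = jump de := List.mem_singleton.1 hm
    exact hEB (Language.append_mem_mul hx rfl)
  · exact hE rfl x hx

/-- The words that lead to a letter after the head `de`. -/
def plDe : Move 5 → Language (Move 5) := pl DeBc DeAb (DeAc + DeBc') (base de ac) 0

/-- The words that lead to a letter after the heads `cd` and `ce`. -/
def plC : Move 5 → Language (Move 5) := pl (CAb * DeBc) CAb CAb (CAb * base de ac) (CAb * jmp de)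

theorem plDe_next {f : Color 5} (hf : f ∈ [c, d, e]) (h1 : Ok de f m) (h2 : Ok de f m')
    (h3 : Next de m m') (hx : x ∈ plDe m) : x ++ [m'] ∈ plDe m' := by
  obtain ⟨h4, h5, h6⟩ := mem_src de (by simp) f hf m h1 m' h2 h3
  refine pl_next deBc_mul_loop ?_ ?_ ?_ ?_ ?_ h4 (fun h => absurd h (h6 rfl)) h5 hx
  · intro x hx
    exact Or.inr (mul_jmp_le_mul_opt hx)
  · intro x hx
    exact Or.inl (mul_jmp_le_mul_opt hx)
  · rw [zero_mul]; exact bot_le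
  · rw [zero_mul]; exact bot_le
  · rw [zero_mul]; exact bot_le

theorem debc'_le_cAb : CAb * DeBc * opt ae * opt ad * opt ac * opt ab ≤ CAb := by
  refine le_trans (le_of_eq ?_)
    ((mul_le_mul_right (show DeBc' ≤ CAbLoop from fun x hx => Or.inr hx) CAb).trans cAb_mul_loop)
  simp only [DeBc', mul_assoc]

theorem deAc_le_cAb : CAb * base de ac * opt ab ≤ CAb := by
  rw [mul_assoc]
  exact ((mul_le_mul_right (show DeAc ≤ CAbLoop from fun x hx => Or.inl (Or.inr hx)) CAb).trans
    cAb_mul_loop)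

theorem mul_step_le {L : Language (Move 5)} {p q : Color 5} :
    L * jmp p * {[step q]} ≤ L * base p q := by
  rintro _ ⟨x, hx, _, rfl, rfl⟩
  exact step_mem_mul_base hx

theorem cAb_loop_debc : CAb * DeBc * DeBcLoop ≤ CAb * DeBc := by
  rw [mul_assoc]
  exact mul_le_mul_right deBc_mul_loop CAb

theorem plC_le (hm : m ∈ [step cd, jump be, jump bd, step bd, jump bc, step bc, jump ae, jump ad,
    jump ac, jump ab, step ab, step ac]) (hx : x ∈ plC m) : x ∈ CAb := by
  have h : m ∈ [step cd, jump be, jump bd, step bd, jump bc, step bc, jump ae, jump ad, jump ac] ∨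
      m = jump ab ∨ m = step ab ∨ m = step ac := by
    simp only [List.mem_cons, List.not_mem_nil, or_false] at hm ⊢; tauto
  rcases h with h | rfl | rfl | rfl
  · exact debc'_le_cAb (mem_mul_opt (mul_opt_ac_of_pl cAb_loop_debc h hx))
  · exact hx
  · exact hx
  · exact deAc_le_cAb (mem_mul_opt hx)

theorem plC_next {p f : Color 5} (hp : p ∈ [cd, ce]) (hf : f ∈ [c, d, e]) (h1 : Ok p f m)
    (h2 : Ok p f m') (h3 : Next p m m') (hx : x ∈ plC m) : x ++ [m'] ∈ plC m' := by
  obtain ⟨h4, h5, h6⟩ := mem_src p (by simp at hp ⊢; tauto) f hf m h1 m' h2 h3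
  refine pl_next cAb_loop_debc ?_ ?_ ?_ ?_ ?_ h4 ?_ h5 hx
  · exact fun x hx => debc'_le_cAb (mul_jmp_le_mul_opt hx)
  · exact fun x hx => deAc_le_cAb (mul_jmp_le_mul_opt hx)
  · exact mul_step_le.trans
      ((mul_le_mul_right (show DeAb ≤ CAbLoop from fun x hx => Or.inl (Or.inl hx)) CAb).trans
        cAb_mul_loop)
  · exact mul_step_le
  · exact mul_step_le.trans (mul_le_mul_right (fun _ h => mem_mul_star h) CAb)
  · rintro rfl x hx
    refine mem_mul_jmp (plC_le (m := m) ?_ hx)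
    have : src (jump de) = [step cd, jump be, jump bd, step bd, jump bc, step bc, jump ae, jump ad,
      jump ac, step ac, jump ab, step ab] := rfl
    rw [this] at h4
    simp only [List.mem_cons, List.not_mem_nil, or_false] at h4 ⊢; tauto

theorem plDe_le (hm : m ∈ [step cd, jump be, jump bd, step bd, jump bc, step bc, jump ae, jump ad,
    jump ac, jump ab, step ab, step ac]) (hx : x ∈ plDe m) : x ∈ DeAb ∨ x ∈ DeAc ∨ x ∈ DeBc' := by
  have h : m ∈ [step cd, jump be, jump bd, step bd, jump bc, step bc, jump ae, jump ad, jump ac] ∨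
      m = jump ab ∨ m = step ab ∨ m = step ac := by
    simp only [List.mem_cons, List.not_mem_nil, or_false] at hm ⊢; tauto
  rcases h with h | rfl | rfl | rfl
  · exact Or.inr (Or.inr (mem_mul_opt (mul_opt_ac_of_pl deBc_mul_loop h hx)))
  · exact Or.inr hx
  · exact Or.inl hx
  · exact Or.inr (Or.inl (mem_mul_opt hx))

/-- The words that lead to a letter after the head `ae`. -/
def plAe (m : Move 5) : Language (Move 5) :=
  if m = step cd then AeCd
  else if m = jump be then AeCd * jmp be
  else if m = jump bd then AeCd * opt be * jmp bd
  else if m = step bd then base ae bd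
  else if m = jump bc then AeCd' + AeBd
  else if m = step bc then AeBc
  else 0

theorem mem_src_ae : ∀ m, Ok ae a m → ∀ m', Ok ae a m' → Next ae m m' →
    (m, m') ∈ [(jump be, step cd), (step cd, jump be), (step cd, jump bd), (jump be, jump bd),
      (step cd, jump bc), (jump be, jump bc), (jump bd, jump bc), (step bd, jump bc)] := by
  decide +kernel

theorem plAe_next (h1 : Ok ae a m) (h2 : Ok ae a m') (h3 : Next ae m m') (hx : x ∈ plAe m) :
    x ++ [m'] ∈ plAe m' := by
  have h := mem_src_ae m h1 m' h2 h3
  simp only [List.mem_cons, List.not_mem_nil, or_false, Prod.mk.injEq] at h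
  rcases h with ⟨rfl, rfl⟩ | ⟨rfl, rfl⟩ | ⟨rfl, rfl⟩ | ⟨rfl, rfl⟩ | ⟨rfl, rfl⟩ | ⟨rfl, rfl⟩ |
    ⟨rfl, rfl⟩ | ⟨rfl, rfl⟩
  · exact mul_mul_star_le (step_mem_mul_base (q := cd) hx)
  · exact mem_mul_jmp hx
  · exact mem_mul_jmp (mem_mul_opt hx)
  · exact mem_mul_jmp (mul_jmp_le_mul_opt hx)
  · exact Or.inl (jump_mem_mul_opt (mem_mul_opt (mem_mul_opt hx)))
  · exact Or.inl (jump_mem_mul_opt (mem_mul_opt (mul_jmp_le_mul_opt hx)))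
  · exact Or.inl (jump_mem_mul_opt (mul_jmp_le_mul_opt hx))
  · exact Or.inr (jump_mem_mul_opt hx)

theorem plAe_le (hx : x ∈ plAe m) : x ∈ AeCd' ∨ x ∈ AeBd ∨ x ∈ AeBc := by
  unfold plAe at hx
  split_ifs at hx
  · exact Or.inl (mem_mul_opt (mem_mul_opt (mem_mul_opt hx)))
  · exact Or.inl (mem_mul_opt (mem_mul_opt (mul_jmp_le_mul_opt hx)))
  · exact Or.inl (mem_mul_opt (mul_jmp_le_mul_opt hx))
  · exact Or.inr (Or.inl (mem_mul_opt hx))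
  · exact hx.imp id Or.inl
  · exact Or.inr (Or.inr hx)
  · exact absurd hx (Language.notMem_zero x)

end Closure

/-! ### Finite checks at the two ends of a pattern -/

/-- The condition that the lower half of the part before the last one, of the color of the letter
`m`, does not exceed the upper half of the last part, of size `k` and the color of `m'`. -/
def Reach (m m' : Move 5) (k : ℕ) : Prop :=
  pos (Part.lower ⟨k + Color.chi m.color m'.color + m'.gap, m.color⟩) ≤
    pos (Part.upper ⟨k, m'.color⟩)

instance (m m' : Move 5) (k : ℕ) : Decidable (Reach m m' k) := by unfold Reach; infer_instance

theorem upOff_le : ∀ q : Color 5, q.IsSecondary → upOff q 0 ≤ 11 ∧ upOff q 1 ≤ 11 := by decide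

-- The last alternative satisfies the local conditions but occurs in no pattern: for these bridges
-- nothing can follow the initial step to `ab`.
set_option synthInstance.maxSize 1000 in
theorem last_secondary_two : ∀ p ∈ [ad, ae, be, cd, ce, de], ∀ m' : Move 5,
    m'.color.IsSecondary →
    upOff m'.color 0 - 15 =
      hgt p (Part.upper ⟨2, m'.color⟩).color - hgt p m'.color →
    ∀ m, Ok p (Part.upper ⟨2, m'.color⟩).color m → Next p m m' → Reach m m' 2 →
      (p = de ∧ (m = step cd ∧ (m' = jump be ∨ m' = jump bd) ∨
        m ∈ [step cd, jump be, jump bd, step bd, jump bc, step bc] ∧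
          (m' = jump ae ∨ m' = jump ad ∧ m.color ≠ be))) ∨
      ((p = cd ∨ p = ce) ∧ (m = step bc ∨ m = jump bc) ∧ m' = jump ac) ∨
      ((p = cd ∨ p = ce) ∧ (Part.upper ⟨2, m'.color⟩).color ∈ [d, e] ∧ m ≠ step ab) := by
  decide +kernel

theorem last_secondary_three : ∀ p ∈ [ad, ae, be, cd, ce, de], ∀ m' : Move 5,
    m'.color.IsSecondary →
    upOff m'.color 1 - 15 =
      hgt p (Part.upper ⟨3, m'.color⟩).color - hgt p m'.color →
    ∀ m, Ok p (Part.upper ⟨3, m'.color⟩).color m → Next p m m' → Reach m m' 3 →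
      (p = cd ∨ p = ce) ∧ (m = jump be ∨ m = jump ae) ∧ m' = step cd := by
  decide +kernel

/-- The heads, second colors and bridge colors of the patterns with a single possible second to
last letter. -/
def singles : List (Color 5 × Color 5 × Color 5) :=
  [(ad, bc, a), (be, cd, b), (ae, cd, b), (de, bc, a), (cd, ab, d), (cd, ab, e), (ce, ab, d),
    (ce, ab, e)]

theorem start_cases : ∀ p q : Color 5, Color.Special p q → ∀ f : Color 5, ¬ f.IsSecondary →
    Ok p f (step q) → (p, q, f) ∈ singles ∨
      (p = ae ∧ f = a) ∨ (p = de ∧ (f = d ∨ f = e)) ∨ ((p = cd ∨ p = ce) ∧ f = c) := by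
  decide +kernel

/-- No secondary color lies strictly between the heights of the bridge and of the second part, and a
step cannot follow a step. -/
theorem single_cases : ∀ s ∈ singles, ∀ m, Ok s.1 s.2.2 m → ¬ Next s.1 (step s.2.1) m := by
  decide +kernel

theorem ok_letters : ∀ p ∈ [cd, ce, de], ∀ f ∈ [c, d, e], ∀ m, Ok p f m →
    m ∈ [step cd, jump be, jump bd, step bd, jump bc, step bc, jump ae, jump ad, jump ac,
        jump ab, step ab, step ac] ∨ p ≠ de ∧ m = jump de := by
  decide +kernel

theorem not_reach_ae : ∀ m, Ok ae a m → ¬ Reach m (jump a) 1 := by decide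

theorem color_of_reach_d : ∀ f ∈ [d, e], ∀ m, Ok de f m → Reach m (jump d) 1 →
    m.color ≠ ae ∧ m.color ≠ be := by decide

theorem color_of_reach_c : ∀ p ∈ [cd, ce], ∀ m, Ok p c m → Reach m (jump c) 1 →
    m ∈ [step cd, jump be, jump bd, step bd, jump bc, step bc, jump ae, jump ad, jump ac,
        jump ab, step ab, step ac] ∧ (m.color = ac ∨ m.color = ab ∨ m.color = bc) := by
  decide +kernel

theorem special_head : ∀ p q : Color 5, Color.Special p q → p ∈ [ad, ae, be, cd, ce, de] := by
  decide

theorem special_start : ∀ p q : Color 5, Color.Special p q →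
    (p = de → q = ab ∨ q = ac ∨ q = bc) ∧ (p = cd ∨ p = ce → q = ab) ∧
      (p = ae → q = bc ∨ q = bd ∨ q = cd) := by
  decide

/-! ### Every profile is listed -/

section

variable {p : ℕ → Part 5} {n : ℕ} {f : Color 5}

theorem Profile.word_mem_plDe (hP : Profile p (n + 2) f) (h0 : (p 0).color = de)
    (hf : f ∈ [c, d, e]) : word p (n + 1) ∈ plDe (letter (p n) (p (n + 1))) := by
  refine hP.word_mem ?_ ?_ n (by omega)
  · rw [h0]
    rcases (special_start _ _ hP.special).1 h0 with h | h | h <;> rw [h]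
    · exact mem_base.2 rfl
    · exact mem_base.2 rfl
    · exact mem_mul_star (L := base de bc) (mem_base.2 rfl)
  · rw [h0]
    exact fun m m' h1 h2 h3 x hx => plDe_next hf h1 h2 h3 hx

theorem Profile.word_mem_plC (hP : Profile p (n + 2) f) (h0 : (p 0).color = cd ∨ (p 0).color = ce)
    (hf : f ∈ [c, d, e]) : word p (n + 1) ∈ plC (letter (p n) (p (n + 1))) := by
  refine hP.word_mem ?_ ?_ n (by omega)
  · rw [(special_start _ _ hP.special).2.1 h0]
    refine mem_mul_star (L := base cd ab + base ce ab) ?_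
    rcases h0 with h | h <;> rw [h]
    · exact Or.inl (mem_base.2 rfl)
    · exact Or.inr (mem_base.2 rfl)
  · exact fun m m' h1 h2 h3 x hx => plC_next (by simpa using h0) hf h1 h2 h3 hx

theorem Profile.word_mem_plAe (hP : Profile p (n + 2) a) (h0 : (p 0).color = ae) :
    word p (n + 1) ∈ plAe (letter (p n) (p (n + 1))) := by
  refine hP.word_mem ?_ ?_ n (by omega)
  · rw [h0]
    rcases (special_start _ _ hP.special).2.2 h0 with h | h | h <;> rw [h]
    · exact mem_base.2 rfl
    · exact mem_base.2 rfl
    · exact mem_mul_star (L := base ae cd) (mem_base.2 rfl)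
  · rw [h0]
    exact fun m m' h1 h2 h3 x hx => plAe_next h1 h2 h3 hx

theorem Profile.eq_zero (hP : Profile p (n + 2) f) {q r : Color 5} (h0 : (p 0).color = q)
    (h1 : (p 1).color = r) (h : ∀ m, Ok q f m → ¬ Next q (step r) m) : n = 0 := by
  by_contra hn
  have h2 := hP.ok 1 (by omega)
  have h3 := hP.next 0 (by omega)
  rw [h0] at h2 h3
  refine h _ h2 ?_
  have h4 : letter (p 0) (p (0 + 1)) = step r := by
    rw [letter, if_pos hP.isStep, h1]
  rwa [h4] at h3

theorem Profile.reach' (hP : Profile p (n + 2) f) :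
    Reach (letter (p n) (p (n + 1))) (letter (p (n + 1)) (p (n + 2))) (p (n + 2)).size := by
  have h1 := hP.reach
  have h2 := hP.size (n + 1) (by omega)
  rw [Reach, letter_color, letter_color, ← h2]
  exact h1

theorem listed_of_profile (hP : Profile p (n + 2) f) :
    Listed (realize (word p (n + 1) ++ [letter (p (n + 1)) (p (n + 2))]) (p (n + 2)).size) := by
  have hreach := hP.reach'
  have hok := hP.ok n (by omega)
  have hnext := hP.next n (by omega)
  have hval := hP.valid
  have hfc := hP.color
  have hh := hP.height
  have hlc := letter_color (p (n + 1)) (p (n + 2))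
  have hends := fun q => endsBy_word p (n + 1) q
  have hsrc := special_head _ _ hP.special
  obtain ⟨k, q, hpn⟩ : ∃ k q, p (n + 2) = ⟨k, q⟩ := ⟨_, _, rfl⟩
  obtain ⟨m, hm⟩ : ∃ m, letter (p n) (p (n + 1)) = m := ⟨_, rfl⟩
  obtain ⟨m', hm'⟩ : ∃ m', letter (p (n + 1)) (p (n + 2)) = m' := ⟨_, rfl⟩
  have hmc := letter_color (p n) (p (n + 1))
  rw [show n + 1 + 1 = n + 2 from rfl] at hnext
  rw [hm'] at hreach hnext hlc
  rw [hpn] at hreach hval hfc hh hlc hm'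
  rw [hm] at hreach hok hnext hmc
  rw [hpn, hm']
  simp only at hreach hlc hval ⊢
  subst hlc
  rw [← hmc] at hends
  by_cases hsec : m'.color.IsSecondary
  · rw [Part.Valid, if_pos hsec] at hval
    rw [pos_upper hsec] at hh
    simp only at hh hval
    have h1 := upOff_le _ hsec
    have h2 := hgt_le (p 0).color f
    have h3 := hgt_le (p 0).color m'.color
    -- Passing to the upper half lowers the height by at most 14, while it changes the place by
    -- `upOff - 15 * (k / 2)` with `upOff ≤ 11`. Hence `k / 2 = 1`.
    have hk : k = 2 ∨ k = 3 := by
      rw [upOff_mod] at hh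
      rcases Nat.mod_two_eq_zero_or_one k with h | h <;> rw [h] at hh <;> omega
    subst hfc
    rcases hk with rfl | rfl
    · rw [upOff_mod] at hh
      simp only [Nat.reduceDiv, Nat.reduceMod] at hh
      rcases last_secondary_two _ hsrc m' hsec (by omega) m hok hnext hreach with
        ⟨h0, ⟨rfl, h⟩ | ⟨h, h'⟩⟩ | ⟨h0, h, rfl⟩ | ⟨h0, h, h'⟩
      · rcases h with rfl | rfl
        · have hw := hP.word_mem_plDe h0 (by decide)
          rw [hm] at hw
          exact .debc_be hw
        · have hw := hP.word_mem_plDe h0 (by decide)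
          rw [hm] at hw
          exact .debc_bd hw
      · rcases h' with rfl | ⟨rfl, h'⟩
        · have hw := hP.word_mem_plDe h0 (by decide)
          rw [hm] at hw
          exact .debc_ae (deBcPrefix_le deBc_mul_loop h hw)
        · have hw := hP.word_mem_plDe h0 (by decide)
          rw [hm] at hw
          exact .debc_ad (deBcPrefix_le deBc_mul_loop h hw) (by rwa [hends])
      · have hw := hP.word_mem_plC h0 (by decide)
        rw [hm] at hw
        rcases h with rfl | rfl
        · exact .cab_ac hw ((hends _).2 rfl)
        · exact .cab_ac hw ((hends _).2 rfl)
      -- The spurious alternative: the pattern has only three parts, so the letter before the last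
      -- is `→ ab`.
      · have h4 := (special_start _ _ hP.special).2.1 h0
        have h5 : ((p 0).color, ab, (Part.upper ⟨2, m'.color⟩).color) ∈ singles := by
          simp only [List.mem_cons, List.not_mem_nil, or_false] at h
          rcases h0 with h0 | h0 <;> rcases h with h | h <;> rw [h0, h] <;> decide
        obtain rfl := hP.eq_zero rfl h4 (single_cases _ h5)
        refine absurd ?_ h'
        rw [← hm, letter, if_pos hP.isStep, h4]
    · rw [upOff_mod] at hh
      simp only [Nat.reduceDiv, Nat.reduceMod] at hh
      obtain ⟨h0, h, rfl⟩ :=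
        last_secondary_three _ hsrc m' hsec (by omega) m hok hnext hreach
      have hw := hP.word_mem_plC h0 (by decide)
      rw [hm] at hw
      rcases h with rfl | rfl
      · exact .cab_be_cd hw
      · exact .cab_ae_cd hw
  · rw [Part.Valid, if_neg hsec] at hval
    simp only at hval
    have hf : f = m'.color := by rw [hfc, upper_of_primary hsec]
    rw [← hf] at hsec
    -- A primary last part is its own bridge, and it cannot be the target of a step.
    have hm'f : m' = jump f := by
      obtain q | q := m'
      · exact absurd (special_secondary _ _ (hnext.2 rfl).1).2 (hf ▸ hsec)
      · rw [hf]; rfl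
    subst hm'f
    have hk : k = 1 ∧ Reach m (jump f) 1 ∨ 2 ≤ k := by
      rcases hval.eq_or_lt with rfl | h
      · exact Or.inl ⟨rfl, hreach⟩
      · exact Or.inr h
    have hok0 := hP.ok 0 (by omega)
    rw [letter, if_pos hP.isStep, zero_add] at hok0
    have hstart := start_cases _ _ hP.special f hsec hok0
    have hsingle : n = 0 → word p (n + 1) = [jump (p 0).color, step (p 1).color] ∧
        m = step (p 1).color := by
      rintro rfl
      rw [← hm]
      simp [word, letter, hP.isStep]
    rcases hstart with hs | ⟨h1, rfl⟩ | ⟨h1, h3⟩ | ⟨h1, rfl⟩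
    · obtain ⟨h1, rfl⟩ := hsingle (hP.eq_zero rfl rfl (single_cases _ hs))
      rw [h1]
      simp only [singles, List.mem_cons, List.not_mem_nil, or_false, Prod.mk.injEq] at hs
      rcases hs with ⟨h1, h2, rfl⟩ | ⟨h1, h2, rfl⟩ | ⟨h1, h2, rfl⟩ | ⟨h1, h2, rfl⟩ | ⟨h1, h2, rfl⟩ |
        ⟨h1, h2, rfl⟩ | ⟨h1, h2, rfl⟩ | ⟨h1, h2, rfl⟩ <;> rw [h2] at hk <;> rw [h1, h2]
      · exact .adbc_a (mem_base.2 rfl) (hk.resolve_left fun h => absurd h.2 (by decide))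
      · exact .becd_b (mem_base.2 rfl) (hk.resolve_left fun h => absurd h.2 (by decide))
      · exact .aecd_b (mem_base.2 rfl) (hk.resolve_left fun h => absurd h.2 (by decide))
      · exact .debc_a (mem_base.2 rfl) (hk.resolve_left fun h => absurd h.2 (by decide))
      · exact .cab_d (Or.inl (mem_base.2 rfl)) hval
      · exact .cab_e (Or.inl (mem_base.2 rfl)) hval
      · exact .cab_d (Or.inr (mem_base.2 rfl)) hval
      · exact .cab_e (Or.inr (mem_base.2 rfl)) hval
    · have hw := hP.word_mem_plAe h1
      rw [hm] at hw
      rw [h1] at hok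
      have hk := hk.resolve_left fun h => not_reach_ae m hok h.2
      rcases plAe_le hw with h | h | h
      · exact .aecd'_a h hk
      · exact .aebd_a h hk
      · exact .aebc_a h hk
    · have hfm : f ∈ [c, d, e] := by rcases h3 with rfl | rfl <;> decide
      have hw := hP.word_mem_plDe h1 hfm
      rw [hm] at hw
      rw [h1] at hok
      have hml := (ok_letters de (by decide) f hfm m hok).resolve_right fun h => h.1 rfl
      rcases h3 with rfl | rfl
      · rcases plDe_le hml hw with h | h | h
        · exact .deab_d h hval
        · exact .deac_d h hval
        · rcases hk with ⟨rfl, hk⟩ | hk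
          · obtain ⟨h3, h4⟩ := color_of_reach_d d (by decide) m hok hk
            exact .debc'_d_one h (by rwa [hends]) (by rwa [hends])
          · exact .debc'_d h hk
      · rcases plDe_le hml hw with h | h | h
        · exact .deab_e h hval
        · exact .deac_e h hval
        · exact .debc'_e h hval
    · have hw := hP.word_mem_plC h1 (by decide)
      rw [hm] at hw
      have h1' : (p 0).color ∈ [cd, ce] := by simpa using h1
      have h1'' : (p 0).color ∈ [cd, ce, de] := by simp; tauto
      rcases hk with ⟨rfl, hk⟩ | hk
      · obtain ⟨h3, h4⟩ := color_of_reach_c _ h1' m hok hk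
        exact .cab_c_one (plC_le h3 hw) (by rwa [hends, hends, hends])
      · rcases ok_letters _ h1'' c (by decide) m hok with h | ⟨-, rfl⟩
        · exact .cab_c (plC_le h hw) hk
        · exact .cab_de_c hw hk

end

/-! ### Profiles with large enough parts are optimal -/

theorem loOff_le : ∀ q : Color 5, q.IsSecondary → loOff q 0 ≤ 11 ∧ loOff q 1 ≤ 11 := by decide

theorem loOff_mod (p : Color 5) (s : ℕ) : loOff p s = loOff p (s % 2) := by
  rw [loOff, loOff, Nat.mod_mod]

/-- The reaching condition for a part of size 4, the smallest even size that is at least 3; larger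
sizes are covered by the crude bound `loOff_le`. -/
theorem loOff_of_ok : ∀ p ∈ [ad, ae, be, cd, ce, de], ∀ f : Color 5, ¬ f.IsSecondary →
    ∀ m, Ok p f m → hgt p m.color + loOff m.color 0 ≤ 15 + hgt p f := by
  decide +kernel

theorem off_of_special : ∀ q q', Color.Special q q' → rk q' < rk q →
    ∀ p ∈ [ad, ae, be, cd, ce, de], ∀ f : Color 5, ¬ f.IsSecondary → Ok p f (jump q) →
      hgt p q + loOff q 1 ≤ 15 + hgt p f ∧ hgt p q + upOff q 1 ≤ 15 := by
  decide +kernel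

theorem eq_step_or_eq_jump (m : Move 5) : m = step m.color ∨ m = jump m.color := by
  cases m
  · exact Or.inl rfl
  · exact Or.inr rfl

section

variable {p : ℕ → Part 5} {n : ℕ} {f : Color 5}

theorem isStep_iff_letter (x y : Part 5) : IsStep x y ↔ letter x y = step y.color := by
  by_cases h : IsStep x y <;> simp [letter, h]

theorem letter_eq_jump {x y : Part 5} (h : ¬ IsStep x y) : letter x y = jump y.color := by
  rw [letter, if_neg h]

theorem Profile.secondary (hP : Profile p n f) {t : ℕ} (ht : t < n) :
    (p t).color.IsSecondary := by
  cases t with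
  | zero => exact (special_secondary _ _ hP.special).1
  | succ t =>
    have h := (hP.ok t ht).1
    rwa [letter_color] at h

/-- Converse bookkeeping: the prescribed size differences make the true height equal to `hgt`, steps
by `hgt_step` and jumps because their drop lies between 1 and 14. -/
theorem Profile.height_eq (hP : Profile p n f) {t : ℕ} (ht : t < n) :
    pos (p (t + 1)) + 15 * (t + 1) - pos (p 0) = hgt (p 0).color (p (t + 1)).color := by
  induction t with
  | zero =>
    have h1 := hP.isStep.2
    have h2 := special_ne _ _ hP.special
    have h3 := rk_lt (p 0).color
    have h4 := rk_lt (p 1).color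
    simp only [chi_eq] at h1
    simp only [zero_add, hgt, pos]
    split_ifs at h1 ⊢ <;> push_cast <;> omega
  | succ t ih =>
    have ih := ih (by omega)
    obtain ⟨-, h1, h2, h3, -⟩ := hP.ok t ht
    obtain ⟨h4, h5⟩ := hP.next t ht
    simp only [letter_color] at h1 h2 h3 h4 h5
    have h6 := hgt_le (p 0).color f
    have hs := hP.size (t + 1) ht
    have h7 := rk_lt (p (t + 1)).color
    have h8 := rk_lt (p (t + 1 + 1)).color
    push_cast at ih ⊢
    by_cases h : IsStep (p (t + 1)) (p (t + 1 + 1))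
    · have h9 := ((isStep_iff_letter _ _).1 h)
      obtain ⟨h10, h11⟩ := h5 h9
      obtain ⟨h12, h13⟩ := hgt_step _ _ h10 (p 0).color (by omega) (h3 h11)
      have h14 := special_ne _ _ h10
      rw [h9] at hs
      simp only [chi_eq, Move.gap] at hs
      have h15 : (hgt (p (t + 1)).color (p (t + 1 + 1)).color : ℤ) =
          15 - (pos (p (t + 1)) - pos (p (t + 1 + 1))) := by
        simp only [hgt, pos]
        split_ifs at hs ⊢ <;> omega
      omega
    · have h9 := letter_eq_jump h
      have h10 := h4 h9
      have h11 := hgt_le (p 0).color (p (t + 1 + 1)).color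
      have h12 := top_le (p 0).color
      rw [h9] at hs
      have h13 : pos (p (t + 1 + 1)) + 15 < pos (p (t + 1)) ∧
          pos (p (t + 1)) ≤ pos (p (t + 1 + 1)) + 30 := by
        simp only [chi_eq, Move.gap] at hs
        simp only [pos]
        split_ifs at hs <;> omega
      have h14 : (15 : ℤ) ∣ hgt (p 0).color (p (t + 1 + 1)).color -
          (rk (p (t + 1 + 1)).color - rk (p 0).color) := by
        have := rk_lt (p 0).color
        simp only [hgt]
        split_ifs <;> omega
      simp only [pos] at *
      omega

theorem Profile.gg (hP : Profile p n f) {t : ℕ} (ht : t < n) : Part.Gg (p t) (p (t + 1)) := by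
  by_cases h : IsStep (p t) (p (t + 1))
  · exact gg_of_isStep h
  · refine gg_of_tri ?_
    have hs := hP.size t ht
    rw [letter_eq_jump h] at hs
    have h1 := rk_lt (p t).color
    have h2 := rk_lt (p (t + 1)).color
    simp only [chi_eq, Move.gap] at hs
    rw [tri_iff]
    simp only [pos]
    split_ifs at hs ⊢ <;> omega

theorem Profile.size_le (hP : Profile p n f) {t u : ℕ} (htu : t ≤ u) (hu : u ≤ n) :
    (p u).size ≤ (p t).size := by
  induction u, htu using Nat.le_induction with
  | base => exact le_rfl
  | succ u h ih =>
    have := hP.size u (by omega)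
    have := ih (by omega)
    omega

/-- Since the next size is also at least 3, the part must be followed by a step with `χ = 0`; this
leaves few colors, for which `off_of_special` applies. -/
theorem Profile.off_of_size_eq_three (hP : Profile p n f) (h3 : 3 ≤ (p (n - 1)).size) {t : ℕ}
    (ht : t + 2 < n) (hs : (p (t + 1)).size = 3) :
    hgt (p 0).color (p (t + 1)).color + loOff (p (t + 1)).color 1 ≤ 15 + hgt (p 0).color f ∧
      hgt (p 0).color (p (t + 1)).color + upOff (p (t + 1)).color 1 ≤ 15 := by
  have h1 := hP.size_le (t := t + 1 + 1) (u := n - 1) (by omega) (by omega)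
  have h2 := hP.size (t + 1) (by omega)
  have h4 : letter (p (t + 1)) (p (t + 1 + 1)) = step (p (t + 1 + 1)).color := by
    by_contra h
    rw [letter_eq_jump (by rwa [isStep_iff_letter])] at h2
    simp only [Move.gap] at h2
    omega
  have h5 := hP.next t (by omega)
  simp only [Next, letter_color] at h5
  obtain ⟨h6, h7⟩ := h5.2 h4
  have h8 := hP.ok t (by omega)
  rw [h7] at h8
  refine off_of_special _ _ h6 ?_ _ (special_head _ _ hP.special) f
    (hP.color ▸ upper_primary _) h8
  rw [chi_eq] at h2
  by_contra h
  rw [if_pos (by omega)] at h2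
  omega

theorem Profile.not_hasDoubleStep (hP : Profile p n f) {ν : List (Part 5)}
    (hl : ν.length = n + 1) (hp : ∀ t (h : t < ν.length), ν[t] = p t) : ¬ HasDoubleStep ν := by
  rw [hasDoubleStep_iff hp, hl]
  rintro ⟨t, ht, h1, h2⟩
  have h := (hP.next t (by omega)).2
  rw [isStep_iff_letter] at h1 h2
  simp only [letter_color, h1] at h
  cases (h h2).2

/-- Once all parts before the last have size at least 3, their lower halves are low enough for the
last part to reach back, and their upper halves too low to cause a violation of their own. Only size
3 needs care. -/
theorem Profile.isOptimalForbidden (hP : Profile p n f) (hn : 2 ≤ n)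
    (h3 : 3 ≤ (p (n - 1)).size)
    (hup : (p (n - 1)).size = 3 →
      hgt (p 0).color (p (n - 1)).color + upOff (p (n - 1)).color 1 ≤ 15) {ν : List (Part 5)}
    (hl : ν.length = n + 1) (hp : ∀ t (h : t < ν.length), ν[t] = p t) : IsOptimalForbidden ν := by
  have hsize : ∀ t < n, 3 ≤ (p t).size := fun t ht =>
    h3.trans (hP.size_le (by omega) (by omega))
  have hpn : pos (p n).upper + 15 * n = pos (p 0) + hgt (p 0).color f := by
    have h1 := hP.height
    have h2 := hP.height_eq (t := n - 1) (by omega)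
    rw [Nat.sub_add_cancel (by omega), Nat.cast_sub (by omega)] at h2
    push_cast at h2
    omega
  have hf0 := hgt_le (p 0).color f
  rw [isOptimalForbidden_iff hl hp (hP.not_hasDoubleStep hl hp)]
  refine ⟨(inE_iff hp).2 ⟨fun t ht => ?_, fun t ht => hP.gg (by omega)⟩,
    ⟨by omega, hP.isStep, fun t _ ht => ⟨hP.secondary ht, ?_⟩, by push_cast; omega⟩, ?_⟩
  · rcases (show t < n ∨ t = n by omega) with h | rfl
    · have := hsize t h
      rw [Part.Valid, if_pos (hP.secondary h)]
      omega
    · exact hP.valid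
  · have hsec := hP.secondary ht
    have hlo := loOff_le _ hsec
    have hs := hsize t ht
    rcases (show t = n - 1 ∨ t = 0 ∨ ∃ t', t = t' + 1 ∧ t' + 2 < n from by
      rcases t with - | t
      · omega
      · by_cases h : t + 2 < n
        · exact Or.inr (Or.inr ⟨t, rfl, h⟩)
        · omega) with rfl | rfl | ⟨t, rfl, ht'⟩
    · have := hP.reach
      rw [Nat.cast_sub (by omega)]
      push_cast
      omega
    · rw [pos_lower hsec, loOff_mod]
      have h1 : pos (p 0) = 15 * (p 0).size + rk (p 0).color := rfl
      rcases Nat.mod_two_eq_zero_or_one (p 0).size with h | h <;> rw [h] <;> push_cast <;> omega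
    · have h1 := hP.height_eq (t := t) (by omega)
      have h2 := hgt_le (p 0).color (p (t + 1)).color
      rw [pos_lower hsec, loOff_mod]
      have h4 : pos (p (t + 1)) = 15 * (p (t + 1)).size + rk (p (t + 1)).color := rfl
      have h5 := hP.off_of_size_eq_three h3 ht'
      have h6 := loOff_of_ok _ (special_head _ _ hP.special) f (hP.color ▸ upper_primary _) _
        (hP.ok t ht)
      rw [letter_color] at h6
      rcases Nat.mod_two_eq_zero_or_one (p (t + 1)).size with h | h <;> rw [h] <;> push_cast <;>
        omega
  · rintro i u hu hiu ⟨hlt, -, -, h⟩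
    have hi : 0 ≤ pos (p i) + 15 * i - pos (p 0) := by
      rcases i with - | i
      · simp
      · have := hP.height_eq (t := i) (by omega)
        push_cast
        omega
    rcases hu.eq_or_lt with rfl | hu
    -- A later part lies above the bridge by `Ok`, so it sees no failure from the last part.
    · obtain ⟨i, rfl⟩ : ∃ i', i = i' + 1 := ⟨i - 1, by omega⟩
      have h1 := hP.height_eq (t := i) (by omega)
      have h2 := (hP.ok i hlt).2.1
      rw [letter_color] at h2
      push_cast at h h1
      omega
    -- All heights are nonnegative, but the upper half at `u` has height at most `15 - 30 + 11` if
    -- the size is at least 4, and at most 0 by `h6` if it is 3.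
    · obtain ⟨u, rfl⟩ : ∃ u', u = u' + 1 := ⟨u - 1, by omega⟩
      have hsec := hP.secondary hu
      have h1 := hP.height_eq (t := u) (by omega)
      have h2 := hsize _ hu
      have h4 := upOff_le _ hsec
      have h5 := hgt_le (p 0).color (p (u + 1)).color
      rw [pos_upper hsec, upOff_mod] at h
      push_cast at h h1
      have h6 : (p (u + 1)).size = 3 →
          hgt (p 0).color (p (u + 1)).color + upOff (p (u + 1)).color 1 ≤ 15 := by
        rcases (show u + 2 < n ∨ u + 1 = n - 1 by omega) with h' | h'
        · exact fun hs => (hP.off_of_size_eq_three h3 h' hs).2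
        · rw [h']
          exact hup
      rcases Nat.mod_two_eq_zero_or_one (p (u + 1)).size with h' | h' <;> rw [h'] at h <;> omega

end

/-! ### Paths of letters and the patterns they realize -/

section Words

variable {h f q : Color 5} {m m' m₁ m₂ : Move 5} {x y : List (Move 5)} {k : ℕ}

theorem length_realize (x : List (Move 5)) (k : ℕ) : (realize x k).length = x.length := by
  induction x with
  | nil => rfl
  | cons m x ih => simp [realize, ih]

theorem getElem_realize (x : List (Move 5)) (k t : ℕ) (ht : t < (realize x k).length) :
    (realize x k)[t] = ⟨firstSize (x.drop t) k, (x.getD t (jump a)).color⟩ := by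
  induction x generalizing t with
  | nil => simp [realize] at ht
  | cons m x ih =>
    cases t with
    | zero => simp [realize]
    | succ t => simpa [realize] using ih t (by simpa [realize] using ht)

theorem firstSize_drop (x : List (Move 5)) (k t : ℕ) (ht : t + 1 < x.length) :
    firstSize (x.drop t) k = firstSize (x.drop (t + 1)) k +
      Color.chi (x.getD t (jump a)).color (x.getD (t + 1) (jump a)).color +
      (x.getD (t + 1) (jump a)).gap := by
  rw [List.drop_eq_getElem_cons (by omega), List.drop_eq_getElem_cons ht, firstSize,
    List.getD_eq_getElem _ _ ht, List.getD_eq_getElem _ _ (by omega)]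

/-- The letters of `x` lead from `m` to `m'` and satisfy the conditions on an optimal forbidden
pattern with head `h` and with a bridge of the color `f`. -/
inductive Path (h f : Color 5) : Move 5 → List (Move 5) → Move 5 → Prop
  | nil (m : Move 5) : Path h f m [] m
  | cons {m m₁ m₂ : Move 5} {x : List (Move 5)} :
      Ok h f m₁ → Next h m m₁ → Path h f m₁ x m₂ → Path h f m (m₁ :: x) m₂

theorem Path.append (h₁ : Path h f m x m₁) (h₂ : Path h f m₁ y m₂) :
    Path h f m (x ++ y) m₂ := by
  induction h₁ with
  | nil => exact h₂
  | cons h h' _ ih => exact .cons h h' (ih h₂)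

theorem Path.ok (hx : Path h f m x m₁) : ∀ m' ∈ x, Ok h f m' := by
  induction hx with
  | nil => simp
  | cons h h' _ ih => simpa using ⟨h, ih⟩

theorem Path.isChain (hx : Path h f m x m₁) (hm : Next h m₁ m') :
    (m :: (x ++ [m'])).IsChain (Next h) := by
  induction hx with
  | nil => simpa using hm
  | cons h h' _ ih => exact .cons_cons h' (ih hm)

theorem Path.getLast? (hx : Path h f m x m₁) : (m :: x).getLast? = some m₁ := by
  induction hx with
  | nil => rfl
  | cons h h' _ ih => rw [List.getLast?_cons_cons, ih]

/-- The conditions on the last letter `m'` and the letter `m` before it. -/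
def LastOk (h f : Color 5) (m m' : Move 5) (k : ℕ) : Prop :=
  Next h m m' ∧ (⟨k, m'.color⟩ : Part 5).Valid ∧ f = (Part.upper ⟨k, m'.color⟩).color ∧
    pos (Part.upper ⟨k, m'.color⟩) - pos ⟨k, m'.color⟩ = hgt h f - hgt h m'.color ∧
    Reach m m' k ∧ 3 ≤ k + Color.chi m.color m'.color + m'.gap ∧
    (k + Color.chi m.color m'.color + m'.gap = 3 → hgt h m.color + upOff m.color 1 ≤ 15)

instance (h f : Color 5) (m m' : Move 5) (k : ℕ) : Decidable (LastOk h f m m' k) := by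
  unfold LastOk; infer_instance

theorem special_of_next (hm : m = step m.color) (h' : Next h m₁ m) :
    Color.Special m₁.color m.color := (h'.2 hm).1

/-- Realizing a path gives a profile, because its conditions are local in the letters; `LastOk`
supplies the conditions on the end and on the size before it. -/
theorem optimal_of_path (hs : Color.Special h q) (h1 : Ok h f (step q))
    (hx : Path h f (step q) x m) (hm : LastOk h f m m' k) :
    IsOptimalForbidden (realize ([jump h, step q] ++ x ++ [m']) k) ∧
      ¬ HasDoubleStep (realize ([jump h, step q] ++ x ++ [m']) k) := by
  obtain ⟨hnext, hval, hcol, hheight, hreach, h3, h3'⟩ := hm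
  have hch := hx.isChain hnext
  have hlast := hx.getLast?
  obtain ⟨w, hw⟩ : ∃ w, w = [jump h, step q] ++ x ++ [m'] := ⟨_, rfl⟩
  obtain ⟨v, hv⟩ : ∃ v, v = step q :: (x ++ [m']) := ⟨_, rfl⟩
  obtain ⟨n, hn⟩ : ∃ n, n = x.length + 2 := ⟨_, rfl⟩
  have hwv : w = jump h :: v := by rw [hw, hv]; rfl
  have hvl : v.length = n := by rw [hv, hn]; simp
  have hwl : w.length = n + 1 := by rw [hwv, List.length_cons, hvl]
  rw [← hw]
  rw [← hv, List.isChain_iff_getElem] at hch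
  -- The default letter only makes `l` total; the indices that matter are at most `n`.
  obtain ⟨l, hl⟩ : ∃ l : ℕ → Move 5, ∀ t, l t = w.getD t (jump a) := ⟨_, fun _ => rfl⟩
  obtain ⟨p, hp⟩ : ∃ p : ℕ → Part 5, ∀ t, p t = ⟨firstSize (w.drop t) k, (l t).color⟩ :=
    ⟨_, fun _ => rfl⟩
  have hl0 : l 0 = jump h := by rw [hl, hwv]; rfl
  have hl1 : l 1 = step q := by rw [hl, hwv, hv]; rfl
  have hln : l n = m' := by
    rw [hl, hw, hn, List.getD_append_right _ _ _ _ (by simp)]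
    simp
  have hlm : l (n - 1) = m := by
    rw [hl, hw, hn, List.getD_append _ _ _ _ (by simp),
      List.getD_eq_getElem _ _ (by simp)]
    rw [List.getLast?_eq_getElem?] at hlast
    simp only [List.length_cons, Nat.add_sub_cancel, List.getElem?_eq_some_iff] at hlast
    obtain ⟨_, rfl⟩ := hlast
    simp
  have hlnext : ∀ t, t + 1 < n → Next h (l (t + 1)) (l (t + 2)) := by
    intro t ht
    have := hch t (by omega)
    rw [hl, hl, List.getD_eq_getElem _ _ (by omega), List.getD_eq_getElem _ _ (by omega)]
    simpa [hwv] using this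
  have hlok : ∀ t, t + 1 < n → Ok h f (l (t + 1)) := by
    intro t ht
    cases t with
    | zero => rwa [hl1]
    | succ t =>
      refine hx.ok _ ?_
      rw [hl, hw, List.getD_append _ _ _ _ (by simp; omega),
        List.getD_eq_getElem _ _ (by simp; omega)]
      simp
  have hcolor : ∀ t, (p t).color = (l t).color := fun t => by rw [hp]
  have hsize : ∀ t < n, (p t).size = (p (t + 1)).size +
      Color.chi (p t).color (p (t + 1)).color + (l (t + 1)).gap := by
    intro t ht
    rw [hp, hp, hl, hl]
    exact firstSize_drop w k t (by omega)
  have hletter : ∀ t < n, letter (p t) (p (t + 1)) = l (t + 1) := by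
    intro t ht
    have h2 := hsize t ht
    rcases eq_step_or_eq_jump (l (t + 1)) with h' | h'
    · rw [letter, if_pos, hcolor, ← h']
      refine ⟨?_, by rw [h'] at h2; exact h2⟩
      rw [hcolor, hcolor]
      cases t with
      | zero => rwa [hl0, hl1]
      | succ t => exact special_of_next h' (hlnext t ht)
    · rw [letter, if_neg, hcolor, ← h']
      rintro ⟨-, h4⟩
      rw [h'] at h2
      simp only [Move.gap] at h2
      omega
  have hpn : p n = ⟨k, m'.color⟩ := by
    rw [hp, hln, hw, List.drop_append_of_le_length (by simp [hn]),
      List.drop_of_length_le (by simp [hn])]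
    rfl
  have hp0 : (p 0).color = h := by rw [hcolor, hl0]; rfl
  have hp1 : (p 1).color = q := by rw [hcolor, hl1]; rfl
  have hpm := hsize (n - 1) (by omega)
  rw [Nat.sub_add_cancel (by omega), hpn, hcolor, hlm, hln] at hpm
  simp only at hpm
  have hpm' : p (n - 1) = ⟨k + Color.chi m.color m'.color + m'.gap, m.color⟩ := by
    rw [← hpm, ← hlm, ← hcolor]
  have hP : Profile p n f :=
    { special := by rwa [hp0, hp1]
      isStep := by
        rw [isStep_iff_letter]
        exact (hletter 0 (by omega)).trans (by rw [zero_add, hl1, hp1])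
      ok := fun t ht => by rw [hp0, hletter t (by omega)]; exact hlok t ht
      next := fun t ht => by
        rw [hp0, hletter t (by omega), hletter (t + 1) ht]; exact hlnext t ht
      size := fun t ht => by rw [hletter t ht]; exact hsize t ht
      valid := by rwa [hpn]
      color := by rwa [hpn]
      height := by rwa [hp0, hpn]
      reach := by rw [hpn, hpm']; exact hreach }
  have hlen : (realize w k).length = n + 1 := by rw [length_realize, hwl]
  have hν : ∀ t (ht : t < (realize w k).length), (realize w k)[t] = p t := fun t ht => by
    rw [getElem_realize, hp, hl]
  exact ⟨hP.isOptimalForbidden (by omega) (by rwa [hpm']) (by rwa [hpm', hp0]) hlen hν,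
    hP.not_hasDoubleStep hlen hν⟩

end Words

/-! ### Listed languages consist of paths -/

section Traverse

variable {h f p q : Color 5} {S T U : List (Move 5)} {L M : Language (Move 5)}

/-- The words of `L` lead from each letter of `S` to a letter of `T`. -/
def Trav (h f : Color 5) (S : List (Move 5)) (L : Language (Move 5)) (T : List (Move 5)) :
    Prop :=
  ∀ m ∈ S, ∀ x ∈ L, ∃ m' ∈ T, Path h f m x m'

theorem Trav.mul (h₁ : Trav h f S L T) (h₂ : Trav h f T M U) : Trav h f S (L * M) U := by
  rintro m hm _ ⟨x, hx, y, hy, rfl⟩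
  obtain ⟨m₁, hm₁, hx⟩ := h₁ m hm x hx
  obtain ⟨m₂, hm₂, hy⟩ := h₂ m₁ hm₁ y hy
  exact ⟨m₂, hm₂, hx.append hy⟩

theorem Trav.add (h₁ : Trav h f S L T) (h₂ : Trav h f S M T) : Trav h f S (L + M) T := by
  rintro m hm x (hx | hx)
  · exact h₁ m hm x hx
  · exact h₂ m hm x hx

theorem Trav.star (h₁ : Trav h f S L S) : Trav h f S L∗ S := by
  intro m hm x hx
  obtain ⟨l, rfl, hl⟩ := Language.mem_kstar.1 hx
  induction l generalizing m with
  | nil => exact ⟨m, hm, .nil m⟩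
  | cons y l ih =>
    obtain ⟨m₁, hm₁, hy⟩ := h₁ m hm y (hl y (by simp))
    obtain ⟨m₂, hm₂, hy₂⟩ := ih m₁ hm₁ (fun z hz => hl z (by simp [hz]))
      (Language.join_mem_kstar fun z hz => hl z (by simp [hz]))
    exact ⟨m₂, hm₂, hy.append hy₂⟩

theorem Trav.mono {S' T' : List (Move 5)} (h₁ : Trav h f S L T) (hS : S' ⊆ S) (hT : T ⊆ T') :
    Trav h f S' L T' := by
  intro m hm x hx
  obtain ⟨m', hm', hx⟩ := h₁ m (hS hm) x hx
  exact ⟨m', hT hm', hx⟩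

theorem trav_jmp (h₁ : ∀ m ∈ S, Ok h f (jump p) ∧ Next h m (jump p)) :
    Trav h f S (jmp p) [jump p] := by
  rintro m hm _ rfl
  exact ⟨_, by simp, .cons (h₁ m hm).1 (h₁ m hm).2 (.nil _)⟩

theorem trav_opt (h₁ : ∀ m ∈ S, Ok h f (jump p) ∧ Next h m (jump p)) :
    Trav h f S (opt p) (jump p :: S) := by
  rintro m hm x (hx | hx)
  · rw [(Language.mem_one x).1 hx]
    exact ⟨m, by simp [hm], .nil m⟩
  · obtain ⟨m', hm', hx⟩ := trav_jmp h₁ m hm x hx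
    exact ⟨m', by simp at hm'; simp [hm'], hx⟩

theorem trav_base (h₁ : ∀ m ∈ S, Ok h f (jump p) ∧ Next h m (jump p))
    (h₂ : Ok h f (step q) ∧ Next h (jump p) (step q)) : Trav h f S (base p q) [step q] := by
  rintro m hm _ rfl
  exact ⟨_, by simp, .cons (h₁ m hm).1 (h₁ m hm).2 (.cons h₂.1 h₂.2 (.nil _))⟩

/-- The heads and the colors of the bridge of the patterns in which `DeBc` occurs. -/
def params : List (Color 5 × Color 5) := [(de, d), (de, e), (cd, c), (ce, c)]

/-- The last letters of the words of `AeCd (↠ be) (↠ bd) (↠ bc)`. -/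
def endsAeCd' : List (Move 5) := [jump bc, jump bd, jump be, step cd]

/-- The last letters of the words of `DeBc`. -/
def endsDeBc : List (Move 5) := [step bc, step bd] ++ endsAeCd'

/-- The last letters of the words of `DeBc'`. -/
def endsDeBc' : List (Move 5) := [jump ab, jump ac, jump ad, jump ae] ++ endsDeBc

/-- The last letters of the words of `CAb`. -/
def endsCAb : List (Move 5) := [step ab, step ac] ++ endsDeBc'

theorem trav_beCd : ∀ s ∈ (ae, a) :: params, Trav s.1 s.2 [step cd] BeCd∗ [step cd] := by
  intro s hs
  refine (trav_base ?_ ?_).star <;> revert s <;> decide +kernel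

theorem trav_optBe : ∀ s ∈ (ae, a) :: params,
    Trav s.1 s.2 [step cd] (opt be * opt bd * opt bc) endsAeCd' := by
  intro s hs
  refine ((trav_opt ?_).mul (trav_opt ?_)).mul (trav_opt ?_) <;> revert s <;> decide +kernel

theorem trav_aeCd : ∀ s ∈ params, Trav s.1 s.2 endsDeBc AeCd [step cd] := by
  intro s hs
  refine (trav_base ?_ ?_).mul (trav_beCd s (by simp [hs])) <;> revert s <;> decide +kernel

theorem trav_loop : ∀ s ∈ params, Trav s.1 s.2 endsDeBc DeBcLoop endsDeBc := by
  intro s hs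
  refine ((Trav.add ?_ ?_).add ?_).add ?_
  · have h1 := (trav_aeCd s hs).mul (trav_optBe s (by simp [hs]))
    rw [← mul_assoc, ← mul_assoc] at h1
    exact h1.mono (List.Subset.refl _) (by decide)
  · refine Trav.mono ((trav_base (S := endsDeBc) (p := ae) (q := bd) ?_ ?_).mul
      (trav_opt (p := bc) ?_)) (List.Subset.refl _) (by decide)
    all_goals revert s; decide +kernel
  · refine Trav.mono (trav_base (S := endsDeBc) (p := ae) (q := bc) ?_ ?_)
      (List.Subset.refl _) (by decide)
    all_goals revert s; decide +kernel
  · refine Trav.mono ((trav_opt (S := endsDeBc) (p := ae) ?_).mul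
      (trav_base (p := ad) (q := bc) ?_ ?_)) (List.Subset.refl _) (by decide)
    all_goals revert s; decide +kernel

theorem trav_optAe : ∀ s ∈ params,
    Trav s.1 s.2 endsDeBc (opt ae * opt ad * opt ac * opt ab) endsDeBc' := by
  intro s hs
  refine (((trav_opt ?_).mul (trav_opt ?_)).mul (trav_opt ?_)).mul (trav_opt ?_) <;>
    revert s <;> decide +kernel

/-- The heads and the colors of the bridge of the patterns in which `CAb` occurs. -/
def paramsC : List (Color 5 × Color 5) := [(cd, c), (ce, c)]

theorem paramsC_subset : paramsC ⊆ params := by decide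

theorem trav_deBc : ∀ s ∈ paramsC, Trav s.1 s.2 endsCAb DeBc endsDeBc := by
  intro s hs
  refine Trav.mul ?_ (trav_loop s (paramsC_subset hs)).star
  refine Trav.mono (trav_base ?_ ?_) (List.Subset.refl _) (by decide)
  all_goals revert s; decide +kernel

theorem trav_cAbLoop : ∀ s ∈ paramsC, Trav s.1 s.2 endsCAb CAbLoop endsCAb := by
  intro s hs
  refine (Trav.add ?_ ?_).add ?_
  · refine Trav.mono (trav_base (p := de) (q := ab) ?_ ?_) (List.Subset.refl _) (by decide)
    all_goals revert s; decide +kernel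
  · refine Trav.mono ((trav_base (p := de) (q := ac) ?_ ?_).mul (trav_opt (p := ab) ?_))
      (List.Subset.refl _) (by decide)
    all_goals revert s; decide +kernel
  · have h1 := (trav_deBc s hs).mul (trav_optAe s (paramsC_subset hs))
    rw [← mul_assoc, ← mul_assoc, ← mul_assoc] at h1
    exact h1.mono (List.Subset.refl _) (by decide)

end Traverse

/-! ### From a path to an optimal pattern -/

section Optimal

variable {h f q : Color 5} {m m' : Move 5} {x : List (Move 5)} {k : ℕ}
  {S T : List (Move 5)} {L M : Language (Move 5)}

/-- The word `x` starts with `h → q` and leads on to the letter `m`. -/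
def Leads (h q f : Color 5) (x : List (Move 5)) (m : Move 5) : Prop :=
  ∃ y, x = [jump h, step q] ++ y ∧ Path h f (step q) y m

theorem leads_base (hx : x ∈ base h q) : Leads h q f x (step q) :=
  ⟨[], by rw [mem_base.1 hx, List.append_nil], .nil _⟩

theorem leads_mul (hL : ∀ x ∈ L, ∃ m ∈ S, Leads h q f x m) (hM : Trav h f S M T) :
    ∀ x ∈ L * M, ∃ m ∈ T, Leads h q f x m := by
  rintro _ ⟨x, hx, y, hy, rfl⟩
  obtain ⟨m, hm, z, rfl, hz⟩ := hL x hx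
  obtain ⟨m', hm', hy⟩ := hM m hm y hy
  exact ⟨m', hm', z ++ y, List.append_assoc _ _ _, hz.append hy⟩

theorem Leads.endsBy (hx : Leads h q f x m) (p : Color 5) : EndsBy x p ↔ m.color = p := by
  obtain ⟨y, rfl, hy⟩ := hx
  have h1 : ([jump h, step q] ++ y).getLast? = some m := by
    rw [← hy.getLast?]
    rfl
  rw [EndsBy, h1]
  simp

theorem Leads.optimal (hx : Leads h q f x m) (hs : Color.Special h q ∧ Ok h f (step q))
    (hm : LastOk h f m m' k) :
    IsOptimalForbidden (realize (x ++ [m']) k) ∧ ¬ HasDoubleStep (realize (x ++ [m']) k) := by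
  obtain ⟨y, rfl, hy⟩ := hx
  exact optimal_of_path hs.1 hs.2 hy hm

/-- The heads and the colors of the bridge of the listed patterns. -/
def heads : List (Color 5 × Color 5) :=
  [(ad, a), (be, b), (ae, a), (ae, b), (de, a), (de, d), (de, e), (cd, c), (cd, d), (cd, e),
    (ce, c), (ce, d), (ce, e)]

theorem upOff_of_ok : ∀ s ∈ heads, ∀ m, Ok s.1 s.2 m → rk s.2 < rk m.color →
    hgt s.1 m.color + upOff m.color 1 ≤ 15 := by
  decide +kernel

theorem not_secondary_of_mem_heads : ∀ s ∈ heads, ¬ s.2.IsSecondary := by decide +kernel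

theorem color_jump (p : Color 5) : (jump p).color = p := rfl

theorem gap_jump (p : Color 5) : (jump p).gap = 1 := rfl

theorem rk_lower : ∀ p f : Color 5, p.IsSecondary → ¬ f.IsSecondary → rk p ≤ rk f →
    rk p + loOff p 0 ≤ rk f := by decide

theorem rk_add_loOff_lt (p : Color 5) (s : ℕ) : rk p + loOff p s < 15 := by
  have := rk_lt (Part.lower ⟨s % 2, p⟩).color
  rw [loOff]
  omega

/-- For a primary last part of size at least 2 nothing depends on the preceding letter beyond `Ok`.
Equality of sizes in the reaching condition occurs only for `k = 2` after a part of size 4, where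
`rk_lower` decides. -/
theorem lastOk_jump (hh : (h, f) ∈ heads) (hm : Ok h f m) (hk : 2 ≤ k) :
    LastOk h f m (jump f) k := by
  have hf : ¬ f.IsSecondary := not_secondary_of_mem_heads _ hh
  have h1 : (⟨k, f⟩ : Part 5).upper = ⟨k, f⟩ := upper_of_primary hf
  refine ⟨⟨fun _ => hm.2.1, fun h => by cases h⟩, ?_, ?_, ?_, ?_, ?_, ?_⟩
  · rw [Part.Valid, if_neg (by exact hf)]
    exact one_le_two.trans hk
  · simp only [color_jump, h1]
  · simp only [color_jump, h1]
    ring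
  · simp only [Reach, color_jump, h1, gap_jump]
    rw [pos_lower hm.1, add_assoc, loOff_mod]
    simp only [pos, chi_eq]
    have h2 := rk_add_loOff_lt m.color ((k + 0 + 1) % 2)
    have h3 := rk_add_loOff_lt m.color ((k + 1 + 1) % 2)
    have h4 := rk_lower m.color f hm.1 hf
    split_ifs with h5
    · have h6 := h4 h5
      rcases hk.eq_or_lt with rfl | hk
      · simpa using h6
      · omega
    · omega
  · simp only [gap_jump]
    omega
  · intro hs
    simp only [color_jump, gap_jump, chi_eq] at hs
    refine upOff_of_ok _ hh m hm ?_
    simp only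
    split_ifs at hs <;> omega

theorem ok_of_leads (hx : Leads h q f x m) (hs : Ok h f (step q)) : Ok h f m := by
  obtain ⟨y, -, hy⟩ := hx
  have h1 := hy.getLast?
  cases y with
  | nil =>
    cases h1
    exact hs
  | cons m₁ y =>
    rw [List.getLast?_cons_cons] at h1
    exact hy.ok _ (List.mem_of_getLast? h1)

theorem Leads.optimal_of_two_le (hx : Leads h q f x m)
    (hs : Color.Special h q ∧ Ok h f (step q) ∧ (h, f) ∈ heads) (hk : 2 ≤ k) :
    IsOptimalForbidden (realize (x ++ [jump f]) k) ∧
      ¬ HasDoubleStep (realize (x ++ [jump f]) k) :=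
  hx.optimal ⟨hs.1, hs.2.1⟩ (lastOk_jump hs.2.2 (ok_of_leads hx hs.2.1) hk)

theorem Leads.optimal_of_one_le (hx : Leads h q f x m)
    (hs : Color.Special h q ∧ Ok h f (step q) ∧ (h, f) ∈ heads)
    (hm : LastOk h f m (jump f) 1) (hk : 1 ≤ k) :
    IsOptimalForbidden (realize (x ++ [jump f]) k) ∧
      ¬ HasDoubleStep (realize (x ++ [jump f]) k) := by
  rcases hk.eq_or_lt with rfl | hk
  · exact hx.optimal ⟨hs.1, hs.2.1⟩ hm
  · exact hx.optimal_of_two_le hs hk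

end Optimal

/-! ### The listed families, case by case -/

section

variable {f : Color 5} {x : List (Move 5)}

theorem leads_deAc (hf : f = d ∨ f = e) :
    ∀ x ∈ DeAc, ∃ m ∈ [jump ab, step ac], Leads de ac f x m :=
  leads_mul (S := [step ac]) (fun x hx => ⟨_, by simp, leads_base hx⟩)
    (trav_opt (by rcases hf with rfl | rfl <;> decide))

theorem leads_deBc (hf : f = d ∨ f = e) : ∀ x ∈ DeBc, ∃ m ∈ endsDeBc, Leads de bc f x m := by
  have hs : (de, f) ∈ params := by rcases hf with rfl | rfl <;> decide
  refine leads_mul (S := endsDeBc) (fun x hx => ⟨step bc, by decide, leads_base hx⟩)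
    (trav_loop _ hs).star

theorem leads_deBc' (hf : f = d ∨ f = e) : ∀ x ∈ DeBc', ∃ m ∈ endsDeBc', Leads de bc f x m := by
  have hs : (de, f) ∈ params := by rcases hf with rfl | rfl <;> decide
  have h1 := leads_mul (leads_deBc hf) (trav_optAe _ hs)
  rw [← mul_assoc, ← mul_assoc, ← mul_assoc] at h1
  exact h1

theorem leads_deBc_aeCd (hf : f = d ∨ f = e) :
    ∀ x ∈ DeBc * AeCd, ∃ m ∈ [step cd], Leads de bc f x m := by
  have hs : (de, f) ∈ params := by rcases hf with rfl | rfl <;> decide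
  exact leads_mul (leads_deBc hf) (trav_aeCd _ hs)

theorem leads_aeBd : ∀ x ∈ AeBd, ∃ m ∈ [jump bc, step bd], Leads ae bd a x m :=
  leads_mul (S := [step bd]) (fun x hx => ⟨_, by simp, leads_base hx⟩) (trav_opt (by decide))

theorem leads_aeCd : ∀ x ∈ AeCd, ∃ m ∈ [step cd], Leads ae cd a x m :=
  leads_mul (S := [step cd]) (fun x hx => ⟨_, by simp, leads_base hx⟩)
    (trav_beCd (ae, a) (by simp))

theorem leads_aeCd' : ∀ x ∈ AeCd', ∃ m ∈ endsAeCd', Leads ae cd a x m := by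
  have h1 := leads_mul leads_aeCd (trav_optBe (ae, a) (by simp))
  rw [← mul_assoc, ← mul_assoc] at h1
  exact h1

theorem leads_cAb : ∀ x ∈ CAb, ∃ h, (h = cd ∨ h = ce) ∧ ∃ m ∈ endsCAb, Leads h ab c x m := by
  rintro _ ⟨x, hx, y, hy, rfl⟩
  have h1 : ∀ h, (h, c) ∈ paramsC → ∀ z ∈ base h ab * CAbLoop∗, ∃ m ∈ endsCAb,
      Leads h ab c z m := fun h hs =>
    leads_mul (S := endsCAb) (fun x hx => ⟨step ab, by decide, leads_base hx⟩)
      (trav_cAbLoop _ hs).star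
  rcases hx with hx | hx
  · exact ⟨cd, Or.inl rfl, h1 cd (by decide) _ (Language.append_mem_mul hx hy)⟩
  · exact ⟨ce, Or.inr rfl, h1 ce (by decide) _ (Language.append_mem_mul hx hy)⟩

theorem leads_cAb_mul {L : Language (Move 5)} {T : List (Move 5)}
    (hL : ∀ s ∈ paramsC, Trav s.1 s.2 endsCAb L T) :
    ∀ x ∈ CAb * L, ∃ h, (h = cd ∨ h = ce) ∧ ∃ m ∈ T, Leads h ab c x m := by
  rintro _ ⟨x, hx, y, hy, rfl⟩
  obtain ⟨h, hh, m, hm, hx⟩ := leads_cAb x hx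
  -- The head depends on the word, so the product lemma is applied to the single word `x`.
  refine ⟨h, hh, leads_mul (L := {x}) (S := endsCAb) ?_ (hL (h, c) ?_) _
    (Language.append_mem_mul rfl hy)⟩
  · rintro _ rfl
    exact ⟨m, hm, hx⟩
  · rcases hh with rfl | rfl <;> decide

theorem trav_deBc_aeCd : ∀ s ∈ paramsC, Trav s.1 s.2 endsCAb (DeBc * AeCd) [step cd] :=
  fun s hs => (trav_deBc s hs).mul (trav_aeCd s (paramsC_subset hs))

theorem lastOk_deAc : ∀ f ∈ [d, e], ∀ m ∈ [jump ab, step ac], LastOk de f m (jump f) 1 := by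
  decide +kernel

theorem lastOk_deBc'_e : ∀ m ∈ endsDeBc', LastOk de e m (jump e) 1 := by decide +kernel

theorem lastOk_deBc'_d : ∀ m ∈ endsDeBc', m.color ≠ ae → m.color ≠ be →
    LastOk de d m (jump d) 1 := by decide +kernel

theorem lastOk_deBc_ad : ∀ m ∈ endsDeBc, m.color ≠ be → LastOk de d m (jump ad) 2 := by
  decide +kernel

theorem lastOk_deBc_ae : ∀ m ∈ endsDeBc, LastOk de e m (jump ae) 2 := by
  decide +kernel

theorem lastOk_cAb : ∀ h ∈ [cd, ce], ∀ m ∈ endsCAb, m.color = ac ∨ m.color = ab ∨ m.color = bc →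
    LastOk h c m (jump c) 1 := by
  decide +kernel

theorem lastOk_cAb_ac : ∀ h ∈ [cd, ce], ∀ m ∈ endsDeBc, m.color = bc →
    LastOk h c m (jump ac) 2 := by
  decide +kernel

end

theorem optimal_of_listed {ν : List (Part 5)} (hν : Listed ν) :
    IsOptimalForbidden ν ∧ ¬ HasDoubleStep ν := by
  cases hν with
  | adbc_a hw hk => exact (leads_base hw).optimal_of_two_le (by decide +kernel) hk
  | becd_b hw hk => exact (leads_base hw).optimal_of_two_le (by decide +kernel) hk
  | deab_d hw hk => exact (leads_base hw).optimal_of_one_le (by decide +kernel) (by decide) hk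
  | deab_e hw hk => exact (leads_base hw).optimal_of_one_le (by decide +kernel) (by decide) hk
  | deac_d hw hk =>
    obtain ⟨m, hm, hw⟩ := leads_deAc (Or.inl rfl) _ hw
    exact hw.optimal_of_one_le (by decide +kernel) (lastOk_deAc _ (by simp) m hm) hk
  | deac_e hw hk =>
    obtain ⟨m, hm, hw⟩ := leads_deAc (Or.inr rfl) _ hw
    exact hw.optimal_of_one_le (by decide +kernel) (lastOk_deAc _ (by simp) m hm) hk
  | aebc_a hw hk => exact (leads_base hw).optimal_of_two_le (by decide +kernel) hk
  | aebd_a hw hk =>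
    obtain ⟨m, hm, hw⟩ := leads_aeBd _ hw
    exact hw.optimal_of_two_le (by decide +kernel) hk
  | aecd_b hw hk => exact (leads_base hw).optimal_of_two_le (by decide +kernel) hk
  | aecd_a hw hk =>
    obtain ⟨m, hm, hw⟩ := leads_aeCd _ hw
    exact hw.optimal_of_two_le (by decide +kernel) hk
  | aecd'_a hw hk =>
    obtain ⟨m, hm, hw⟩ := leads_aeCd' _ hw
    exact hw.optimal_of_two_le (by decide +kernel) hk
  | debc_a hw hk => exact (leads_base hw).optimal_of_two_le (by decide +kernel) hk
  | debc_e hw hk =>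
    obtain ⟨m, hm, hw⟩ := leads_deBc (Or.inr rfl) _ hw
    exact hw.optimal_of_one_le (by decide +kernel)
      (lastOk_deBc'_e m (List.mem_append_right _ hm)) hk
  | debc'_e hw hk =>
    obtain ⟨m, hm, hw⟩ := leads_deBc' (Or.inr rfl) _ hw
    exact hw.optimal_of_one_le (by decide +kernel) (lastOk_deBc'_e m hm) hk
  | debc'_d hw hk =>
    obtain ⟨m, hm, hw⟩ := leads_deBc' (Or.inl rfl) _ hw
    exact hw.optimal_of_two_le (by decide +kernel) hk
  | debc'_d_one hw h1 h2 =>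
    obtain ⟨m, hm, hw⟩ := leads_deBc' (Or.inl rfl) _ hw
    rw [hw.endsBy] at h1 h2
    exact hw.optimal (by decide +kernel) (lastOk_deBc'_d m hm h1 h2)
  | debc_be hw =>
    obtain ⟨m, hm, hw⟩ := leads_deBc_aeCd (Or.inr rfl) _ hw
    obtain rfl := List.mem_singleton.1 hm
    exact hw.optimal (by decide +kernel) (by decide)
  | debc_bd hw =>
    obtain ⟨m, hm, hw⟩ := leads_deBc_aeCd (Or.inl rfl) _ hw
    obtain rfl := List.mem_singleton.1 hm
    exact hw.optimal (by decide +kernel) (by decide)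
  | debc_ae hw =>
    obtain ⟨m, hm, hw⟩ := leads_deBc (Or.inr rfl) _ hw
    exact hw.optimal (by decide +kernel) (lastOk_deBc_ae m hm)
  | debc_ad hw h1 =>
    obtain ⟨m, hm, hw⟩ := leads_deBc (Or.inl rfl) _ hw
    rw [hw.endsBy] at h1
    exact hw.optimal (by decide +kernel) (lastOk_deBc_ad m hm h1)
  | cab_d hw hk =>
    rcases hw with hw | hw
    · exact (leads_base hw).optimal_of_one_le (by decide +kernel) (by decide) hk
    · exact (leads_base hw).optimal_of_one_le (by decide +kernel) (by decide) hk
  | cab_e hw hk =>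
    rcases hw with hw | hw
    · exact (leads_base hw).optimal_of_one_le (by decide +kernel) (by decide) hk
    · exact (leads_base hw).optimal_of_one_le (by decide +kernel) (by decide) hk
  | cab_c hw hk =>
    obtain ⟨h, hh, m, hm, hw⟩ := leads_cAb _ hw
    exact hw.optimal_of_two_le (by rcases hh with rfl | rfl <;> decide +kernel) hk
  | cab_de_c hw hk =>
    obtain ⟨h, hh, m, hm, hw⟩ :=
      leads_cAb_mul (fun s hs => trav_jmp (by revert s; decide +kernel)) _ hw
    exact hw.optimal_of_two_le (by rcases hh with rfl | rfl <;> decide +kernel) hk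
  | cab_c_one hw h1 =>
    obtain ⟨h, hh, m, hm, hw⟩ := leads_cAb _ hw
    rw [hw.endsBy, hw.endsBy, hw.endsBy] at h1
    exact hw.optimal (by rcases hh with rfl | rfl <;> decide +kernel)
      (lastOk_cAb h (by simpa using hh) m hm h1)
  | cab_be_cd hw =>
    have h1 := leads_cAb_mul (L := DeBc * AeCd * jmp be) (T := [jump be]) fun s hs =>
      (trav_deBc_aeCd s hs).mul (trav_jmp (by revert s; decide +kernel))
    rw [← mul_assoc, ← mul_assoc] at h1
    obtain ⟨h, hh, m, hm, hw⟩ := h1 _ hw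
    obtain rfl := List.mem_singleton.1 hm
    rcases hh with rfl | rfl
    · exact hw.optimal (by decide +kernel) (by decide)
    · exact hw.optimal (by decide +kernel) (by decide)
  | cab_ae_cd hw =>
    have h1 := leads_cAb_mul (L := DeBc * jmp ae) (T := [jump ae]) fun s hs =>
      (trav_deBc s hs).mul (trav_jmp (by revert s; decide +kernel))
    rw [← mul_assoc] at h1
    obtain ⟨h, hh, m, hm, hw⟩ := h1 _ hw
    obtain rfl := List.mem_singleton.1 hm
    rcases hh with rfl | rfl
    · exact hw.optimal (by decide +kernel) (by decide)
    · exact hw.optimal (by decide +kernel) (by decide)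
  | cab_ac hw h1 =>
    obtain ⟨h, hh, m, hm, hw⟩ := leads_cAb_mul trav_deBc _ hw
    rw [hw.endsBy] at h1
    exact hw.optimal (by rcases hh with rfl | rfl <;> decide +kernel)
      (lastOk_cAb_ac h (by simpa using hh) m hm h1)

theorem listed_of_optimal {ν : List (Part 5)} (ho : IsOptimalForbidden ν)
    (hd : ¬ HasDoubleStep ν) : Listed ν := by
  obtain ⟨n, hn⟩ : ∃ n, ν.length = n + 1 := by
    cases ν with
    | nil => exact absurd ho.2.1 ho.1.2
    | cons x l => exact ⟨l.length, rfl⟩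
  -- The default part lies beyond the end of the pattern and plays no role.
  obtain ⟨p, hp⟩ : ∃ p : ℕ → Part 5, ∀ t (h : t < ν.length), ν[t] = p t :=
    ⟨fun t => ν.getD t ⟨0, a⟩, fun t h => (List.getD_eq_getElem _ _ h).symm⟩
  rw [isOptimalForbidden_iff hn hp hd, inE_iff hp, hn] at ho
  rw [hasDoubleStep_iff hp, hn] at hd
  obtain ⟨⟨hval, hgg⟩, hv, hnv⟩ := ho
  obtain ⟨h2, hP⟩ := profile_of_optimal (fun t ht => hval t (by omega))
    (fun t ht => hgg t (by omega)) (fun t ht h => hd ⟨t, by omega, h⟩) hv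
    fun i hi => hnv i n le_rfl (Or.inl hi)
  obtain ⟨n, rfl⟩ : ∃ n', n = n' + 2 := ⟨n - 2, by omega⟩
  have h1 := listed_of_profile hP
  rw [← word_succ, word, realize_word p (n + 1 + 1) _ rfl hP.size] at h1
  convert h1 using 1
  refine List.ext_getElem (by simp [hn]) fun t h3 h4 => ?_
  rw [hp t h3]
  simp

/-! ### Infinitely many color sequences -/

/-- The word of `ae → cd ↠ be → cd ↠ ⋯ ↠ be → cd` with `n` moves `be → cd`. -/
def aeCdWord (n : ℕ) : List (Move 5) :=
  [jump ae, step cd] ++ (List.replicate n [jump be, step cd]).flatten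

theorem aeCdWord_mem (n : ℕ) : aeCdWord n ∈ AeCd :=
  Language.append_mem_mul (mem_base.2 rfl)
    (Language.join_mem_kstar fun _ hy => List.eq_of_mem_replicate hy)

theorem infinite_colors : (List.map Part.color ''
    {ν : List (Part 5) | IsOptimalForbidden ν ∧ ¬ HasDoubleStep ν}).Infinite := by
  refine Set.infinite_of_injective_forall_mem
    (f := fun n : ℕ => (realize (aeCdWord n ++ [jump a]) 2).map Part.color) ?_
    fun n => ⟨_, optimal_of_listed (.aecd_a (aeCdWord_mem n) le_rfl), rfl⟩
  -- The color sequences have length `2 * n + 3`, so their lengths already tell them apart.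
  intro n n' h
  have h1 := congrArg List.length h
  simp [length_realize, aeCdWord] at h1
  exact h1

end Five

end ColoredPattern

theorem mainTheorem6 :
    (∀ ν : List (ColoredPattern.Part 5),
      (ColoredPattern.IsOptimalForbidden ν ∧ ¬ ColoredPattern.HasDoubleStep ν) ↔
        ColoredPattern.Five.Listed ν) ∧
    (List.map ColoredPattern.Part.color ''
      {ν : List (ColoredPattern.Part 5) |
        ColoredPattern.IsOptimalForbidden ν ∧ ¬ ColoredPattern.HasDoubleStep ν}).Infinite ∧
    {ν : List (ColoredPattern.Part 5) | ColoredPattern.IsOptimalForbidden ν}.Infinite :=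
  ⟨fun _ => ⟨fun h => ColoredPattern.Five.listed_of_optimal h.1 h.2,
      ColoredPattern.Five.optimal_of_listed⟩,
    ColoredPattern.Five.infinite_colors,
    (ColoredPattern.Five.infinite_colors.of_image _).mono fun _ h => h.1⟩
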